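/- **Setting.** Let $d,d_o\ge 0$ be integers, let $A$ be a $d\times d$ matrix, $B:\mathbb{R}^d\times\mathbb{R}^d\to\mathbb{R}^d$ a bilinear map, $f\in\mathbb{R}^d$ and $H:\mathbb{R}^d\to\mathbb{R}^{d_o}$ a linear map. Let $R>0$ and assume that there is a $\delta>0$ such that $\langle -Av-B(v,v)+f,\,v\rangle\le 0$ whenever $R\le\|v\|\le R+\delta$. Put $\mathcal{B}_R=\{v\in\mathbb{R}^d:\|v\|\le R\}$. For $v\in\mathcal{B}_R$ and $t\ge 0$ let $\Psi_t(v)$ be the value at time $t$ of the (global) solution of $\frac{dx}{dt}=-Ax-B(x,x)+f$ with $x(0)=v$, and let $\Phi_t(v)=H\Psi_t(v)$. Let $T>0$, and let $u\in\mathbb{R}^d$ with $\|u\|<R$ be such that, for some constants $h_{\max}>0$ and $c>0$, for every $h=T/k\le h_{\max}$ ($k\ge 1$ an integer) and every $v\in\mathcal{B}_R$, $$\sum_{i=0}^{k}\|\Phi_{ih}(v)-\Phi_{ih}(u)\|^2\ge \frac{c}{h}\|u-v\|^2 .$$ Let the prior $q$ be a probability density on $\mathbb{R}^d$ that vanishes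 outside $\mathcal{B}_R$, is strictly positive and continuous on $\mathcal{B}_R$, is three times continuously differentiable in the interior of $\mathcal{B}_R$, and is such that the derivatives of $\log q$ of orders $1,2,3$ are bounded in the interior of $\mathcal{B}_R$. For $h=T/k$ and $\sigma_Z>0$ the observations are $Y_j=\Phi_{jh}(u)+Z_j$, $0\le j\le k$, where $u$ is fixed and $Z_0,Z_1,\dots$ are i.i.d. random vectors in $\mathbb{R}^{d_o}$ whose components are i.i.d. $N(0,\sigma_Z^2)$, with density $\eta$. The smoothing density is $\mu^{\mathrm{sm}}(v|Y_{0:k})\propto q(v)\prod_{i=0}^k\eta(Y_i-\Phi_{ih}(v))$ on $\mathcal{B}_R$ (and $0$ elsewhere), $\hat u_{\mathrm{MAP}}$ denotes any maximizer of it over $\mathcal{B}_R$, and $$g^{\mathrm{sm}}(v)=-\log q(v)+\frac{1}{2\sigma_Z^2}\sum_{i=0}^{k}\|Y_i-\Phi_{ih}(v)\|^2,\qquad v\in\mathcal{B}_R .$$ **Theorem (Convergence of Newton's method to the MAP).** There are finite constants $0<D_{\max}\le N$, depending only on $A,B,f,H,R,u,T,c,h_{\max}$ (not on $q,\epsilon,h,\sigma_Z$),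 and for every such $q$ and every $0<\epsilon\le 1$ there is a constant $S_{\max}>0$ (which may in addition depend on $q$ and $\epsilon$, but not on $h,\sigma_Z$), such that the following holds. If $h=T/k\le h_{\max}$, $\sigma_Z>0$ and $\sigma_Z\sqrt h\le S_{\max}$, then there is an event of probability at least $1-\epsilon$ on which a maximizer $\hat u_{\mathrm{MAP}}$ exists and, for every $x_0\in\mathcal{B}_R$ with $\|x_0-u\|<D_{\max}$, the Newton iterates $$x_{i+1}=x_i-(\nabla^2 g^{\mathrm{sm}}(x_i))^{-1}\,\nabla g^{\mathrm{sm}}(x_i),\qquad i\in\mathbb{N},$$ are well defined (every $x_i$ is an interior point of $\mathcal{B}_R$ at which $g^{\mathrm{sm}}$ is twice continuously differentiable with invertible Hessian), and every maximizer $\hat u_{\mathrm{MAP}}$ satisfies $\|x_0-\hat u_{\mathrm{MAP}}\|<N$ and $$\|x_i-\hat u_{\mathrm{MAP}}\|\le N\left(\frac{\|x_0-\hat u_{\mathrm{MAP}}\|}{N}\right)^{2^i}\qquad\text{for every } i\in\mathbb{N}.$$ -/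

import Mathlib

open MeasureTheory ProbabilityTheory

/-- Coefficients of the dynamics `u' = -A u - B(u, u) + f` on `ℝ^d`, together with the linear
observation operator `H : ℝ^d → ℝ^m`. -/
structure ObservedSystem (d m : ℕ) where
  A : EuclideanSpace ℝ (Fin d) →L[ℝ] EuclideanSpace ℝ (Fin d)
  B : EuclideanSpace ℝ (Fin d) →L[ℝ] EuclideanSpace ℝ (Fin d) →L[ℝ] EuclideanSpace ℝ (Fin d)
  f : EuclideanSpace ℝ (Fin d)
  H : EuclideanSpace ℝ (Fin d) →L[ℝ] EuclideanSpace ℝ (Fin m)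

namespace ObservedSystem

variable {d m : ℕ} (M : ObservedSystem d m)

/-- The right-hand side `-A v - B(v, v) + f` of the differential equation. -/
noncomputable def field (v : EuclideanSpace ℝ (Fin d)) : EuclideanSpace ℝ (Fin d) :=
  -M.A v - M.B v v + M.f

/-- The trapping ball condition for the radius `R`. -/
def TrappingBall (R : ℝ) : Prop :=
  ∃ δ : ℝ, 0 < δ ∧ ∀ v : EuclideanSpace ℝ (Fin d), R ≤ ‖v‖ → ‖v‖ ≤ R + δ →
    inner ℝ (M.field v) v ≤ 0

/-- `x` solves the differential equation on `[0, ∞)` with initial condition `x 0 = v`. -/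
def IsSolution (v : EuclideanSpace ℝ (Fin d)) (x : ℝ → EuclideanSpace ℝ (Fin d)) : Prop :=
  x 0 = v ∧ ∀ t : ℝ, 0 ≤ t → HasDerivWithinAt x (M.field (x t)) (Set.Ici 0) t

open Classical in
/-- The solution semigroup `Ψ_t(v)`, for `t ≥ 0`: the value at time `t` of the solution started
from `v`. (Where no global solution exists, the value is the arbitrary `v`; under the trapping ball
condition this does not happen for `‖v‖ ≤ R`. Solutions are unique on `[0, ∞)`, because the field
is locally Lipschitz, so that the choice is immaterial.) -/
noncomputable def flow (t : ℝ) (v : EuclideanSpace ℝ (Fin d)) : EuclideanSpace ℝ (Fin d) :=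
  if h : ∃ x, M.IsSolution v x then h.choose t else v

/-- The observed part of the dynamics, `Φ_t(v) = H Ψ_t(v)`. -/
noncomputable def obs (t : ℝ) (v : EuclideanSpace ℝ (Fin d)) : EuclideanSpace ℝ (Fin m) :=
  M.H (M.flow t v)

/-- The observability assumption at the initial point `u`, for the time horizon `T`, with the
constants `hmax` and `c`: for all step sizes `h = T / k ≤ hmax` and all `‖v‖ ≤ R`,
`∑_{i=0}^k ‖Φ_{ih}(v) - Φ_{ih}(u)‖² ≥ (c / h) ‖u - v‖²`. -/
structure Observability (R : ℝ) (u : EuclideanSpace ℝ (Fin d)) (T hmax c : ℝ) : Prop where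
  norm_lt : ‖u‖ < R
  hmax_pos : 0 < hmax
  c_pos : 0 < c
  lower_bound : ∀ (k : ℕ) (h : ℝ), 0 < h → T = k * h → h ≤ hmax →
    ∀ v ∈ Metric.closedBall (0 : EuclideanSpace ℝ (Fin d)) R,
      c / h * ‖u - v‖ ^ 2 ≤
        ∑ i ∈ Finset.range (k + 1), ‖M.obs (i * h) v - M.obs (i * h) u‖ ^ 2

/-- The observations `Y_j = Φ_{jh}(u) + z_j` produced by the initial point `u` and the noise
values `z_0, z_1, …`. -/
noncomputable def observations (h : ℝ) (u : EuclideanSpace ℝ (Fin d))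
    (z : ℕ → EuclideanSpace ℝ (Fin m)) (j : ℕ) : EuclideanSpace ℝ (Fin m) :=
  M.obs (j * h) u + z j

end ObservedSystem

/-- The assumptions on the prior density `q`: it is a probability density supported on the closed
ball of radius `R`, strictly positive and continuous there, three times continuously differentiable
in the interior, where the derivatives of `log q` of orders 1, 2 and 3 are bounded. -/
structure IsAdmissiblePrior {d : ℕ} (R : ℝ) (q : EuclideanSpace ℝ (Fin d) → ℝ) : Prop where
  zero_outside : ∀ v, v ∉ Metric.closedBall (0 : EuclideanSpace ℝ (Fin d)) R → q v = 0
  pos : ∀ v ∈ Metric.closedBall (0 : EuclideanSpace ℝ (Fin d)) R, 0 < q v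
  continuousOn : ContinuousOn q (Metric.closedBall 0 R)
  integral_eq_one : ∫ v, q v = 1
  contDiffOn : ContDiffOn ℝ 3 q (Metric.ball 0 R)
  bounded_log : ∀ i : ℕ, 1 ≤ i → i ≤ 3 → ∃ C : ℝ,
    ∀ v ∈ Metric.ball (0 : EuclideanSpace ℝ (Fin d)) R,
      ‖iteratedFDeriv ℝ i (fun w => Real.log (q w)) v‖ ≤ C

/-- `Z_0, Z_1, …` are i.i.d. random vectors in `ℝ^m` whose components are i.i.d. centered
Gaussians of variance `σ²`. -/
structure IsGaussianNoise {m : ℕ} {Ω : Type*} [MeasurableSpace Ω] (σ : ℝ) (P : Measure Ω)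
    (Z : ℕ → Ω → EuclideanSpace ℝ (Fin m)) : Prop where
  measurable : ∀ j, Measurable (Z j)
  indep : iIndepFun (fun (p : ℕ × Fin m) (ω : Ω) => Z p.1 ω p.2) P
  law : ∀ (j : ℕ) (l : Fin m), P.map (fun ω => Z j ω l) = gaussianReal 0 (σ ^ 2).toNNReal

/-- The density `η` on `ℝ^m` of a vector with i.i.d. centered Gaussian components of
variance `σ²`. -/
noncomputable def noiseDensity {m : ℕ} (σ : ℝ) (y : EuclideanSpace ℝ (Fin m)) : ℝ :=
  ∏ l : Fin m, gaussianPDFReal 0 (σ ^ 2).toNNReal (y l)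

namespace ObservedSystem

variable {d m : ℕ} (M : ObservedSystem d m)

/-- `[∏_{i=0}^k η(Y_i - Φ_{ih}(v))] q(v)`. -/
noncomputable def likelihoodPrior (q : EuclideanSpace ℝ (Fin d) → ℝ) (σ h : ℝ) (k : ℕ)
    (Y : ℕ → EuclideanSpace ℝ (Fin m)) (v : EuclideanSpace ℝ (Fin d)) : ℝ :=
  (∏ i ∈ Finset.range (k + 1), noiseDensity σ (Y i - M.obs (i * h) v)) * q v

open Classical in
/-- The density `μ^sm(v | Y_0, …, Y_k)` of the smoothing distribution. -/
noncomputable def smoothingDensity (R : ℝ) (q : EuclideanSpace ℝ (Fin d) → ℝ) (σ h : ℝ) (k : ℕ)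
    (Y : ℕ → EuclideanSpace ℝ (Fin m)) (v : EuclideanSpace ℝ (Fin d)) : ℝ :=
  if v ∈ Metric.closedBall (0 : EuclideanSpace ℝ (Fin d)) R then
    M.likelihoodPrior q σ h k Y v /
      ∫ w in Metric.closedBall (0 : EuclideanSpace ℝ (Fin d)) R, M.likelihoodPrior q σ h k Y w
  else 0

/-- `a` is a maximum-a-posteriori point of the smoothing distribution, that is, a maximizer of its
density over the closed ball of radius `R`. -/
def IsMAP (R : ℝ) (q : EuclideanSpace ℝ (Fin d) → ℝ) (σ h : ℝ) (k : ℕ)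
    (Y : ℕ → EuclideanSpace ℝ (Fin m)) (a : EuclideanSpace ℝ (Fin d)) : Prop :=
  a ∈ Metric.closedBall (0 : EuclideanSpace ℝ (Fin d)) R ∧
    IsMaxOn (M.smoothingDensity R q σ h k Y) (Metric.closedBall 0 R) a

/-- `g^sm(v) = -log q(v) + (1 / (2σ²)) ∑_{i=0}^k ‖Y_i - Φ_{ih}(v)‖²`, the negative log-posterior
up to an additive constant; only its values on the closed ball of radius `R` are meaningful. -/
noncomputable def gsm (q : EuclideanSpace ℝ (Fin d) → ℝ) (σ h : ℝ) (k : ℕ)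
    (Y : ℕ → EuclideanSpace ℝ (Fin m)) (v : EuclideanSpace ℝ (Fin d)) : ℝ :=
  -Real.log (q v) +
    1 / (2 * σ ^ 2) * ∑ i ∈ Finset.range (k + 1), ‖Y i - M.obs (i * h) v‖ ^ 2

end ObservedSystem

/-- The Hessian `∇² g(x)`, as a linear operator. -/
noncomputable def hessian {d : ℕ} (g : EuclideanSpace ℝ (Fin d) → ℝ)
    (x : EuclideanSpace ℝ (Fin d)) : EuclideanSpace ℝ (Fin d) →L[ℝ] EuclideanSpace ℝ (Fin d) :=
  fderiv ℝ (gradient g) x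

/-- Newton's iterates `x_{i+1} = x_i - (∇² g(x_i))⁻¹ ∇ g(x_i)`. -/
noncomputable def newtonIterate {d : ℕ} (g : EuclideanSpace ℝ (Fin d) → ℝ)
    (x₀ : EuclideanSpace ℝ (Fin d)) : ℕ → EuclideanSpace ℝ (Fin d)
  | 0 => x₀
  | i + 1 => newtonIterate g x₀ i -
      (hessian g (newtonIterate g x₀ i)).inverse (gradient g (newtonIterate g x₀ i))

/-- Newton's iterates for a function `g` on the ball of radius `R` are well defined: each of them
is an interior point of the ball at which `g` is twice continuously differentiable with invertible
Hessian. -/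
def NewtonWellDefined {d : ℕ} (R : ℝ) (g : EuclideanSpace ℝ (Fin d) → ℝ)
    (x₀ : EuclideanSpace ℝ (Fin d)) : Prop :=
  ∀ i : ℕ, newtonIterate g x₀ i ∈ Metric.ball (0 : EuclideanSpace ℝ (Fin d)) R ∧
    ContDiffAt ℝ 2 g (newtonIterate g x₀ i) ∧
    (hessian g (newtonIterate g x₀ i)).IsInvertible

/-! Multiply `g` by `s = σ²h`. Up to an additive constant, `s g = φ + p`. Here `φ(v) = (h/2) ∑
‖Φ_{ih}(v) - Φ_{ih}(u)‖²` is noise-free, and `p` collects the term `-h ∑ ⟨Z_i, Φ_{ih}(v)⟩` and `-s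
log q` (`TrappingBall.mul_gsm_eq`). Observability says `φ(v) ≥ (c/2)‖v - u‖²`, with equality at `u`,
so the second derivative of `φ` at `u` is at least `c`. The third derivatives of `φ` are bounded by
a constant `C` independent of `h`.

If `p` and its derivatives of orders 2 and 3 are small, every minimizer of `g` lies within `D` of
`u`. Near `u`, `g` is then strongly convex with constant `c/(4s)` and has third derivative at most
`(C + 1)/s`, so Newton's method converges quadratically (`newton_convergence_of_perturbation`). Only
the ratio of these two constants matters. The factor `s` cancels in it, so `N` and `D` depend on
neither the prior nor the noise.

The noise term has to be small uniformly in `v`, together with its derivatives. Writing the path as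
its initial value plus the integral of its velocity and summing by parts turns this term into a
continuous linear functional of the pair (initial value, velocity). Its norm is controlled by the
partial sums of the `Z_i` alone (`norm_noiseFunctionalPair_le`). The pair is a deterministic C³
function of `v` with bounded derivatives, so one scalar event suffices: `noiseSize` has expectation
of order `σ²h`, and Markov's inequality applies.

C³ dependence of the path on `v` comes from the inverse function theorem in `C([0,T])` applied to `x
↦ x - ∫ field(x)`, whose derivative is the identity minus a Volterra operator and hence invertible
(`eventually_solutionPath`). -/

section Volterra

/-! ### Volterra operators on continuous paths -/

variable {E F G : Type*} [NormedAddCommGroup E] [NormedSpace ℝ E]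
  [NormedAddCommGroup F] [NormedSpace ℝ F] [NormedAddCommGroup G] [NormedSpace ℝ G]

/-- The bilinear map induced pointwise on spaces of continuous maps by a bilinear map. -/
noncomputable def pointwiseBilin (α : Type*) [TopologicalSpace α] [CompactSpace α]
    (b : E →L[ℝ] F →L[ℝ] G) : C(α, E) →L[ℝ] C(α, F) →L[ℝ] C(α, G) :=
  LinearMap.mkContinuous₂
    (LinearMap.mk₂ ℝ
      (fun x y => (⟨fun t => b (x t) (y t), by fun_prop⟩ : C(α, G)))
      (fun x x' y => by ext t; simp) (fun r x y => by ext t; simp)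
      (fun x y y' => by ext t; simp) (fun r x y => by ext t; simp))
    ‖b‖ (fun x y => by
      rw [ContinuousMap.norm_le _ (by positivity)]
      intro t
      refine (b.le_opNorm₂ _ _).trans ?_
      gcongr
      · exact x.norm_coe_le_norm t
      · exact y.norm_coe_le_norm t)

@[simp]
lemma pointwiseBilin_apply {α : Type*} [TopologicalSpace α] [CompactSpace α]
    (b : E →L[ℝ] F →L[ℝ] G) (x : C(α, E)) (y : C(α, F)) (t : α) :
    pointwiseBilin α b x y t = b (x t) (y t) := rfl

/-- The constant continuous maps, as a continuous linear map. -/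
noncomputable def constMap (α : Type*) [TopologicalSpace α] [CompactSpace α] :
    E →L[ℝ] C(α, E) :=
  LinearMap.mkContinuous
    { toFun := fun v => ContinuousMap.const α v
      map_add' := fun _ _ => rfl
      map_smul' := fun _ _ => rfl } 1 (fun v => by
      rw [ContinuousMap.norm_le _ (by positivity)]
      exact fun t => (one_mul ‖v‖).ge)

@[simp]
lemma constMap_apply {α : Type*} [TopologicalSpace α] [CompactSpace α] (v : E) (t : α) :
    constMap α v t = v := rfl

variable {T : ℝ}

omit [NormedSpace ℝ E] in
lemma norm_IccExtend_le (hT : 0 ≤ T) (y : C(Set.Icc (0 : ℝ) T, E)) (s : ℝ) :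
    ‖Set.IccExtend hT y s‖ ≤ ‖y‖ := y.norm_coe_le_norm _

omit [NormedSpace ℝ E] in
lemma intervalIntegrable_IccExtend (hT : 0 ≤ T) (y : C(Set.Icc (0 : ℝ) T, E)) (a b : ℝ) :
    IntervalIntegrable (Set.IccExtend hT y) volume a b :=
  (y.continuous.Icc_extend' (h := hT)).intervalIntegrable a b

lemma norm_integral_IccExtend_le (hT : 0 ≤ T) (y : C(Set.Icc (0 : ℝ) T, E)) (a b : ℝ) :
    ‖∫ s in a..b, Set.IccExtend hT y s‖ ≤ ‖y‖ * |b - a| :=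
  intervalIntegral.norm_integral_le_of_norm_le_const fun s _ => norm_IccExtend_le hT y s

/-- The integration operator `y ↦ ∫_0^t y(s) ds` on continuous functions on `[0, T]`. -/
noncomputable def volterra (hT : 0 ≤ T) :
    C(Set.Icc (0 : ℝ) T, E) →L[ℝ] C(Set.Icc (0 : ℝ) T, E) :=
  LinearMap.mkContinuous
    { toFun := fun y => ⟨fun t => ∫ s in (0 : ℝ)..t, Set.IccExtend hT y s,
        (intervalIntegral.continuous_primitive
          (fun a b => intervalIntegrable_IccExtend hT y a b) 0).comp continuous_subtype_val⟩
      map_add' := fun y z => by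
        ext t
        exact intervalIntegral.integral_add (intervalIntegrable_IccExtend hT y _ _)
          (intervalIntegrable_IccExtend hT z _ _)
      map_smul' := fun r y => by
        ext t
        exact intervalIntegral.integral_smul r _ } T (fun y => by
      rw [ContinuousMap.norm_le _ (by positivity)]
      intro t
      refine (norm_integral_IccExtend_le hT y 0 t).trans ?_
      rw [mul_comm, sub_zero, abs_of_nonneg t.2.1]
      gcongr
      exact t.2.2)

lemma volterra_apply (hT : 0 ≤ T) (y : C(Set.Icc (0 : ℝ) T, E)) (t : Set.Icc (0 : ℝ) T) :
    volterra hT y t = ∫ s in (0 : ℝ)..t, Set.IccExtend hT y s := rfl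

lemma norm_volterra_sub_le (hT : 0 ≤ T) (y : C(Set.Icc (0 : ℝ) T, E))
    (s t : Set.Icc (0 : ℝ) T) :
    ‖volterra hT y t - volterra hT y s‖ ≤ ‖y‖ * |(t : ℝ) - s| := by
  rw [volterra_apply, volterra_apply, intervalIntegral.integral_interval_sub_left
    (intervalIntegrable_IccExtend hT y _ _) (intervalIntegrable_IccExtend hT y _ _)]
  exact norm_integral_IccExtend_le hT y s t

lemma norm_volterra_apply_le (hT : 0 ≤ T) (y : C(Set.Icc (0 : ℝ) T, E))
    (t : Set.Icc (0 : ℝ) T) : ‖volterra hT y t‖ ≤ ‖y‖ * T := by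
  refine (norm_integral_IccExtend_le hT y 0 t).trans ?_
  rw [sub_zero, abs_of_nonneg t.2.1]
  gcongr
  exact t.2.2

/-- Because `K` is bounded pointwise in time, and not only in the sup norm, each application
integrates the previous power of `t`; this produces the factorial. -/
lemma norm_volterra_comp_pow_apply_le (hT : 0 ≤ T)
    (K : C(Set.Icc (0 : ℝ) T, E) →L[ℝ] C(Set.Icc (0 : ℝ) T, E)) {C : ℝ} (hC : 0 ≤ C)
    (hK : ∀ y t, ‖K y t‖ ≤ C * ‖y t‖) (n : ℕ) (y : C(Set.Icc (0 : ℝ) T, E))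
    (t : Set.Icc (0 : ℝ) T) :
    ‖((volterra hT ∘L K) ^ n) y t‖ ≤ (C * t) ^ n / n.factorial * ‖y‖ := by
  induction n generalizing t with
  | zero => simpa using y.norm_coe_le_norm t
  | succ n ih =>
    rw [pow_succ']
    set z := ((volterra hT ∘L K) ^ n) y with hz
    have h1 : ((volterra hT ∘L K) * (volterra hT ∘L K) ^ n) y t
        = ∫ s in (0 : ℝ)..t, Set.IccExtend hT (K z) s := rfl
    rw [h1]
    have h2 : ‖∫ s in (0 : ℝ)..t, Set.IccExtend hT (K z) s‖
        ≤ ∫ s in (0 : ℝ)..t, C * ((C * s) ^ n / n.factorial * ‖y‖) := by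
      refine intervalIntegral.norm_integral_le_of_norm_le t.2.1 ?_ ?_
      · refine Filter.Eventually.of_forall fun s hs => ?_
        have hs' : s ∈ Set.Icc (0 : ℝ) T := ⟨hs.1.le, hs.2.trans t.2.2⟩
        rw [Set.IccExtend_of_mem hT _ hs']
        refine (hK z _).trans ?_
        gcongr
        exact ih ⟨s, hs'⟩
      · exact (by fun_prop : Continuous _).intervalIntegrable _ _
    refine h2.trans (le_of_eq ?_)
    have h3 : (fun s : ℝ => C * ((C * s) ^ n / n.factorial * ‖y‖))
        = fun s => (C ^ (n + 1) / n.factorial * ‖y‖) * s ^ n := by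
      funext s; rw [mul_pow]; ring
    rw [h3, intervalIntegral.integral_const_mul, integral_pow, Nat.factorial_succ]
    have : (n.factorial : ℝ) ≠ 0 := by positivity
    push_cast
    field_simp
    simp
    ring

/-- By the factorial bound some power `V^n` has norm below 1, so `1 - V^n` is a unit. The factor `1
- V` commutes with its cofactor, the geometric sum, and is therefore a unit too. No smallness of `T`
or `C` is needed. -/
lemma isUnit_one_sub_volterra_comp [CompleteSpace E] (hT : 0 ≤ T)
    (K : C(Set.Icc (0 : ℝ) T, E) →L[ℝ] C(Set.Icc (0 : ℝ) T, E)) {C : ℝ} (hC : 0 ≤ C)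
    (hK : ∀ y t, ‖K y t‖ ≤ C * ‖y t‖) : IsUnit (1 - volterra hT ∘L K) := by
  obtain ⟨n, hn⟩ := ((FloorSemiring.tendsto_pow_div_factorial_atTop (C * T)).eventually
    (gt_mem_nhds one_pos)).exists
  have h1 : ‖(volterra hT ∘L K) ^ n‖ < 1 := by
    refine lt_of_le_of_lt (ContinuousLinearMap.opNorm_le_bound _ (by positivity) fun y => ?_) hn
    rw [ContinuousMap.norm_le _ (by positivity)]
    intro t
    refine (norm_volterra_comp_pow_apply_le hT K hC hK n y t).trans ?_
    have := t.2.1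
    have := t.2.2
    gcongr
  have h2 : IsUnit (1 - (volterra hT ∘L K) ^ n) :=
    isUnit_one_sub_of_norm_lt_one
      (R := C(Set.Icc (0 : ℝ) T, E) →L[ℝ] C(Set.Icc (0 : ℝ) T, E)) h1
  rw [← mul_neg_geom_sum] at h2
  refine ((Commute.isUnit_mul_iff ?_).1 h2).1
  exact (Commute.sub_left (Commute.one_left _)
    (Commute.sum_right _ _ _ fun i _ => Commute.self_pow _ i))

end Volterra

/-! ### Smooth dependence of solution paths on the initial value -/

section QuadraticODE

variable {E : Type*} [NormedAddCommGroup E] [NormedSpace ℝ E] {T : ℝ}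
  (A : E →L[ℝ] E) (B : E →L[ℝ] E →L[ℝ] E) (f : E)

/-- The quadratic field `-A x - B(x, x) + f` applied pointwise to a continuous path. -/
noncomputable def pathField (x : C(Set.Icc (0 : ℝ) T, E)) : C(Set.Icc (0 : ℝ) T, E) :=
  -(A.compLeftContinuous ℝ (Set.Icc (0 : ℝ) T)) x - pointwiseBilin _ B x x + constMap _ f

/-- `z ↦ -A z - B(x, z) - B(z, y)`, applied pointwise to paths. -/
noncomputable def pathFieldSlope (x y : C(Set.Icc (0 : ℝ) T, E)) :
    C(Set.Icc (0 : ℝ) T, E) →L[ℝ] C(Set.Icc (0 : ℝ) T, E) :=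
  -(A.compLeftContinuous ℝ (Set.Icc (0 : ℝ) T)) - pointwiseBilin _ B x
    - (pointwiseBilin _ B).flip y

lemma contDiff_pathField {n : WithTop ℕ∞} :
    ContDiff ℝ n (pathField A B f : C(Set.Icc (0 : ℝ) T, E) → _) := by
  unfold pathField
  fun_prop

lemma hasStrictFDerivAt_pathField (x : C(Set.Icc (0 : ℝ) T, E)) :
    HasStrictFDerivAt (pathField A B f) (pathFieldSlope A B x x) x := by
  have h1 := (A.compLeftContinuous ℝ (Set.Icc (0 : ℝ) T)).hasStrictFDerivAt (x := x)
  have h2 := (pointwiseBilin (Set.Icc (0 : ℝ) T) B).hasStrictFDerivAt_of_bilinear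
    (hasStrictFDerivAt_id x) (hasStrictFDerivAt_id x)
  refine ((h1.neg.sub h2).add_const (constMap _ f)).congr_fderiv ?_
  ext y t
  simp [pathFieldSlope]
  abel

/-- Since the field is quadratic, `B(x,x) - B(y,y) = B(x,x-y) + B(x-y,y)` gives an exact secant
operator between two arbitrary paths; this yields global uniqueness. -/
lemma pathField_sub (x y : C(Set.Icc (0 : ℝ) T, E)) :
    pathField A B f x - pathField A B f y = pathFieldSlope A B x y (x - y) := by
  ext t
  simp [pathField, pathFieldSlope]
  abel

lemma norm_pathFieldSlope_apply_le (x y z : C(Set.Icc (0 : ℝ) T, E)) (t : Set.Icc (0 : ℝ) T) :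
    ‖pathFieldSlope A B x y z t‖ ≤ (‖A‖ + ‖B‖ * ‖x‖ + ‖B‖ * ‖y‖) * ‖z t‖ := by
  have h : pathFieldSlope A B x y z t = -A (z t) - B (x t) (z t) - B (z t) (y t) := rfl
  rw [h]
  have h1 : ‖A (z t)‖ ≤ ‖A‖ * ‖z t‖ := A.le_opNorm _
  have h2 : ‖B (x t) (z t)‖ ≤ ‖B‖ * ‖x‖ * ‖z t‖ :=
    (B.le_opNorm₂ _ _).trans (by gcongr; exact x.norm_coe_le_norm t)
  have h3 : ‖B (z t) (y t)‖ ≤ ‖B‖ * ‖z t‖ * ‖y‖ :=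
    (B.le_opNorm₂ _ _).trans (by gcongr; exact y.norm_coe_le_norm t)
  calc _ ≤ ‖A (z t)‖ + ‖B (x t) (z t)‖ + ‖B (z t) (y t)‖ := by
        refine (norm_sub_le _ _).trans ?_
        gcongr
        refine (norm_sub_le _ _).trans ?_
        rw [norm_neg]
    _ ≤ _ := by linarith

variable [CompleteSpace E]

/-- The defect `x - ∫_0^t (-A x - B(x, x) + f)`: it is constant exactly when `x` solves the
differential equation. -/
noncomputable def pathDefect (hT : 0 ≤ T) (x : C(Set.Icc (0 : ℝ) T, E)) :
    C(Set.Icc (0 : ℝ) T, E) :=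
  x - volterra hT (pathField A B f x)

lemma isUnit_one_sub_volterra_slope (hT : 0 ≤ T) (x y : C(Set.Icc (0 : ℝ) T, E)) :
    IsUnit (1 - volterra hT ∘L pathFieldSlope A B x y) :=
  isUnit_one_sub_volterra_comp hT _ (by positivity) (norm_pathFieldSlope_apply_le A B x y)

/-- The difference of two defects is `1 - V`, with `V` the Volterra operator of the secant, applied
to `x - y`; as `1 - V` is invertible, equal defects force `x = y`. -/
lemma pathDefect_injective (hT : 0 ≤ T) :
    Function.Injective (pathDefect A B f hT) := by
  intro x y hxy
  obtain ⟨e, he⟩ := isUnit_one_sub_volterra_slope A B hT x y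
  have h1 : (1 - volterra hT ∘L pathFieldSlope A B x y) (x - y) = 0 := by
    have : (1 - volterra hT ∘L pathFieldSlope A B x y) (x - y)
      = pathDefect A B f hT x - pathDefect A B f hT y := by
      have h2 : (1 - volterra hT ∘L pathFieldSlope A B x y) (x - y)
        = (x - y) - volterra hT (pathFieldSlope A B x y (x - y)) := rfl
      rw [h2, ← pathField_sub A B f, map_sub, pathDefect, pathDefect]
      abel
    rw [this, hxy, sub_self]
  rw [← he] at h1
  have h2 : ((e⁻¹).1 * e.1) (x - y) = 0 := by
    rw [mul_apply_eq_comp, h1, map_zero]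
  rw [Units.inv_mul] at h2
  exact sub_eq_zero.1 h2

/-- The initial values from which the quadratic differential equation can be solved on `[0, T]`. -/
def solvable (hT : 0 ≤ T) : Set E := {v | ∃ x, pathDefect A B f hT x = constMap _ v}

/-- The solution path on `[0, T]`, as a function of the initial value. -/
noncomputable def solutionPath (hT : 0 ≤ T) (v : E) : C(Set.Icc (0 : ℝ) T, E) :=
  Function.invFun (pathDefect A B f hT) (constMap _ v)

variable {A B f} in
lemma solutionPath_eq {hT : 0 ≤ T} {v : E} {x : C(Set.Icc (0 : ℝ) T, E)}
    (h : pathDefect A B f hT x = constMap _ v) : solutionPath A B f hT v = x := by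
  rw [solutionPath, ← h]
  exact Function.leftInverse_invFun (pathDefect_injective A B f hT) x

variable {A B f} in
lemma solutionPath_spec {hT : 0 ≤ T} {v : E} (hv : v ∈ solvable A B f hT) :
    solutionPath A B f hT v
      = constMap _ v + volterra hT (pathField A B f (solutionPath A B f hT v)) := by
  obtain ⟨x, hx⟩ := hv
  rw [solutionPath_eq hx, ← hx, pathDefect, sub_add_cancel]

/-- The defect is smooth with invertible derivative at the solution, so it has a C³ local inverse
there. Global injectivity identifies this local inverse, on constant paths, with `solutionPath`. -/
lemma eventually_solutionPath (hT : 0 ≤ T) {v : E} (hv : v ∈ solvable A B f hT) :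
    (∀ᶠ w in nhds v, w ∈ solvable A B f hT) ∧
      ContDiffAt ℝ 3 (solutionPath A B f hT) v := by
  obtain ⟨x, hx⟩ := hv
  obtain ⟨e, he⟩ := isUnit_one_sub_volterra_slope A B hT x x
  let e' := ContinuousLinearEquiv.unitsEquiv ℝ _ e
  have hs : HasStrictFDerivAt (pathDefect A B f hT)
      (e' : C(Set.Icc (0 : ℝ) T, E) →L[ℝ] C(Set.Icc (0 : ℝ) T, E)) x := by
    refine ((hasStrictFDerivAt_id x).sub ((volterra hT).hasStrictFDerivAt.comp x
      (hasStrictFDerivAt_pathField A B f x))).congr_fderiv ?_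
    exact he.symm
  have hc : ContDiffAt ℝ 3 (pathDefect A B f hT) x :=
    (contDiff_id.sub ((volterra hT).contDiff.comp (contDiff_pathField A B f))).contDiffAt
  have hloc := hc.to_localInverse hs.hasFDerivAt (by norm_num)
  have hright := hs.eventually_right_inverse
  rw [hx] at hright
  have h1 : ∀ᶠ w in nhds v, pathDefect A B f hT (hs.localInverse _ _ _ (constMap _ w))
      = constMap _ w := (constMap _).continuous.continuousAt.eventually hright
  refine ⟨h1.mono fun w hw => ⟨_, hw⟩, ?_⟩
  have h2 : solutionPath A B f hT =ᶠ[nhds v]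
      fun w => hs.localInverse _ _ _ (constMap _ w) := h1.mono fun w hw => solutionPath_eq hw
  refine ContDiffAt.congr_of_eventuallyEq ?_ h2
  rw [hx] at hloc
  exact ContDiffAt.comp v hloc (constMap (E := E) (Set.Icc (0 : ℝ) T)).contDiff.contDiffAt

lemma isOpen_solvable (hT : 0 ≤ T) : IsOpen (solvable A B f hT) :=
  isOpen_iff_mem_nhds.2 fun _ hv => (eventually_solutionPath A B f hT hv).1

lemma contDiffOn_solutionPath (hT : 0 ≤ T) :
    ContDiffOn ℝ 3 (solutionPath A B f hT) (solvable A B f hT) :=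
  fun _ hv => (eventually_solutionPath A B f hT hv).2.contDiffWithinAt

lemma mem_solvable_of_hasDerivWithinAt (hT : 0 ≤ T) {x : ℝ → E}
    (hx : ∀ t ∈ Set.Icc 0 T, HasDerivWithinAt x (-A (x t) - B (x t) (x t) + f) (Set.Icc 0 T) t) :
    x 0 ∈ solvable A B f hT ∧
      ∀ t : Set.Icc (0 : ℝ) T, solutionPath A B f hT (x 0) t = x t := by
  have hcont : ContinuousOn x (Set.Icc 0 T) := fun t ht => (hx t ht).continuousWithinAt
  let y : C(Set.Icc (0 : ℝ) T, E) := ⟨fun t => x t, hcont.domRestrict⟩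
  have hy : pathDefect A B f hT y = constMap _ (x 0) := by
    ext t
    have h1 : ∫ s in (0 : ℝ)..t, Set.IccExtend hT (pathField A B f y) s = x t - x 0 := by
      refine intervalIntegral.integral_eq_sub_of_hasDerivAt_of_le t.2.1
        (hcont.mono (Set.Icc_subset_Icc_right t.2.2)) (fun s hs => ?_)
        (intervalIntegrable_IccExtend hT _ _ _)
      have hs' : s ∈ Set.Ioo 0 T := ⟨hs.1, hs.2.trans_le t.2.2⟩
      rw [Set.IccExtend_of_mem hT _ (Set.Ioo_subset_Icc_self hs')]
      exact (hx s (Set.Ioo_subset_Icc_self hs')).hasDerivAt (Icc_mem_nhds hs'.1 hs'.2)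
    change x t - ∫ s in (0 : ℝ)..t, Set.IccExtend hT (pathField A B f y) s = x 0
    rw [h1, sub_sub_cancel]
  exact ⟨⟨y, hy⟩, fun t => by rw [solutionPath_eq hy]; rfl⟩

end QuadraticODE

/-! ### Global existence and invariance of the ball -/

section GlobalExistence

/-- A bounded Lipschitz vector field has global forward solutions. -/
lemma exists_global_solution_of_lipschitz {E : Type*} [NormedAddCommGroup E] [NormedSpace ℝ E]
    [CompleteSpace E] {F : E → E} {K L : NNReal} (hK : LipschitzWith K F) (hL : ∀ v, ‖F v‖ ≤ L)
    (v : E) : ∃ x : ℝ → E, x 0 = v ∧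
      ∀ t, 0 ≤ t → HasDerivWithinAt x (F (x t)) (Set.Ici 0) t := by
  have hex : ∀ n : ℕ, ∃ α : ℝ → E, α 0 = v ∧
      ∀ t ∈ Set.Icc (0 : ℝ) n, HasDerivWithinAt α (F (α t)) (Set.Icc (0 : ℝ) n) t := by
    intro n
    -- A solution of a field bounded by `L` moves at most `L * n` in time `n`, so with this radius
    -- the Picard–Lindelöf condition holds on all of `[0, n]`.
    have hPL : IsPicardLindelof (fun _ : ℝ => F) (tmin := 0) (tmax := n)
        ⟨0, le_rfl, n.cast_nonneg⟩ v (L * n) 0 L K :=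
      { lipschitzOnWith := fun _ _ => hK.lipschitzOnWith
        continuousOn := fun _ _ => continuousOn_const
        norm_le := fun _ _ y _ => hL y
        mul_max_le := by simp }
    exact hPL.exists_eq_forall_mem_Icc_hasDerivWithinAt₀
  choose α hα0 hα using hex
  have hr : ∀ n : ℕ, ∀ t ∈ Set.Ico (0 : ℝ) n,
      HasDerivWithinAt (α n) (F (α n t)) (Set.Ici t) t := fun n t ht =>
    (hα n t ⟨ht.1, ht.2.le⟩).mono_of_mem_nhdsWithin
      (Filter.mem_of_superset (Icc_mem_nhdsGE ht.2) (Set.Icc_subset_Icc_left ht.1))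
  have hagree : ∀ n m : ℕ, n ≤ m → Set.EqOn (α n) (α m) (Set.Icc (0 : ℝ) n) := by
    intro n m hnm
    have hnm' : (n : ℝ) ≤ m := by exact_mod_cast hnm
    refine ODE_solution_unique (v := fun _ => F) (K := K) (fun _ => hK)
      (fun t ht => (hα n t ht).continuousWithinAt) (hr n)
      (fun t ht => ((hα m t ⟨ht.1, ht.2.trans hnm'⟩).mono
        (Set.Icc_subset_Icc_right hnm')).continuousWithinAt)
      (fun t ht => hr m t ⟨ht.1, ht.2.trans_le hnm'⟩) ((hα0 n).trans (hα0 m).symm)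
  -- The index `⌊t⌋₊ + 1` exceeds `t`, so near `t` the glued function agrees with the single
  -- solution of that index.
  refine ⟨fun t => α (⌊t⌋₊ + 1) t, hα0 _, fun t ht => ?_⟩
  have htn : t < ((⌊t⌋₊ + 1 : ℕ) : ℝ) := by exact_mod_cast Nat.lt_floor_add_one t
  have hmem : Set.Icc (0 : ℝ) ((⌊t⌋₊ + 1 : ℕ) : ℝ) ∈ nhdsWithin t (Set.Ici 0) := by
    rw [← Set.Ici_inter_Iic]
    exact inter_mem_nhdsWithin _ (Iic_mem_nhds htn)
  refine ((hα _ t ⟨ht, htn.le⟩).mono_of_mem_nhdsWithin hmem).congr_of_eventuallyEq ?_ rfl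
  have hlt : ∀ᶠ s in nhdsWithin t (Set.Ici 0), s < ((⌊t⌋₊ + 1 : ℕ) : ℝ) :=
    nhdsWithin_le_nhds (Iio_mem_nhds htn)
  filter_upwards [hlt, self_mem_nhdsWithin] with s hs hs0
  have hfl : ⌊s⌋₊ + 1 ≤ ⌊t⌋₊ + 1 := Nat.succ_le_of_lt ((Nat.floor_lt hs0).2 hs)
  exact hagree _ _ hfl ⟨hs0, by exact_mod_cast (Nat.lt_floor_add_one s).le⟩

/-- A solution cannot leave a ball outside of which the field does not point outwards. -/
lemma norm_le_of_inner_field_nonpos {E : Type*} [NormedAddCommGroup E] [InnerProductSpace ℝ E]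
    {F : E → E} {R : ℝ} (hR : 0 ≤ R) (hF : ∀ v, R ≤ ‖v‖ → inner ℝ (F v) v ≤ 0) {x : ℝ → E}
    (hx0 : ‖x 0‖ ≤ R) (hx : ∀ t, 0 ≤ t → HasDerivWithinAt x (F (x t)) (Set.Ici 0) t)
    {t : ℝ} (ht : 0 ≤ t) : ‖x t‖ ≤ R := by
  -- The field gives only a derivative `≤ 0` on and outside the sphere, while the comparison
  -- principle needs a strict inequality at contact; the barrier rises at rate `e`, which then tends
  -- to 0.
  have key : ∀ e : ℝ, 0 < e → ‖x t‖ ^ 2 ≤ R ^ 2 + e * (1 + t) := by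
    intro e he
    have hd : ∀ s ∈ Set.Ico 0 t, HasDerivWithinAt (fun r => ‖x r‖ ^ 2)
        (2 * inner ℝ (x s) (F (x s))) (Set.Ici s) s := fun s hs =>
      ((hx s hs.1).mono (Set.Ici_subset_Ici.2 hs.1)).norm_sq
    refine image_le_of_deriv_right_lt_deriv_boundary' (a := 0) (b := t)
      (f := fun r => ‖x r‖ ^ 2) (B := fun r => R ^ 2 + e * (1 + r)) (B' := fun _ => e) ?_ hd ?_ ?_
      ?_ ?_ (Set.right_mem_Icc.2 ht)
    · exact fun s hs => (((hx s hs.1).mono (Set.Icc_subset_Ici_self)).norm_sq).continuousWithinAt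
    · simp only [add_zero, mul_one]
      have : ‖x 0‖ ^ 2 ≤ R ^ 2 := by gcongr
      linarith
    · fun_prop
    · intro s _
      have : HasDerivAt (fun r : ℝ => R ^ 2 + e * (1 + r)) (e * 1) s :=
        (((hasDerivAt_id s).const_add 1).const_mul e).const_add _
      simpa using this.hasDerivWithinAt
    · intro s hs heq
      have h1 : R ≤ ‖x s‖ := by
        refine le_of_sq_le_sq ?_ (norm_nonneg _)
        have := mul_nonneg he.le (by linarith [hs.1] : 0 ≤ 1 + s)
        linarith
      have := hF _ h1
      rw [real_inner_comm] at this
      linarith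
  have h2 : ‖x t‖ ^ 2 ≤ R ^ 2 := by
    refine le_of_forall_pos_le_add fun e he => ?_
    have := key (e / (1 + t)) (by positivity)
    rwa [div_mul_cancel₀ _ (by positivity)] at this
  exact le_of_sq_le_sq h2 hR

end GlobalExistence

/-! ### The flow started in the trapping ball -/

namespace ObservedSystem

variable {d m : ℕ} (M : ObservedSystem d m)

lemma contDiff_field {n : WithTop ℕ∞} : ContDiff ℝ n M.field := by
  unfold field
  fun_prop

variable {M} {R : ℝ} {v : EuclideanSpace ℝ (Fin d)}

/-- A bump equal to 1 on the ball and vanishing beyond radius `R + δ` makes the field bounded and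
Lipschitz and extends the inward condition to all `‖w‖ ≥ R`. The truncated solution never leaves the
ball, where the truncation is invisible. -/
lemma TrappingBall.exists_isSolution (htrap : M.TrappingBall R) (hR : 0 < R) (hv : ‖v‖ ≤ R) :
    ∃ x, M.IsSolution v x := by
  obtain ⟨δ, hδ, htrap⟩ := htrap
  let χ : ContDiffBump (0 : EuclideanSpace ℝ (Fin d)) := ⟨R, R + δ, hR, by linarith⟩
  let F : EuclideanSpace ℝ (Fin d) → EuclideanSpace ℝ (Fin d) := fun w => χ w • M.field w
  have hFs : ContDiff ℝ 1 F := χ.contDiff.smul M.contDiff_field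
  have hFc : HasCompactSupport F := χ.hasCompactSupport.smul_right
  obtain ⟨K, hK⟩ := ContDiff.lipschitzWith_of_hasCompactSupport hFc hFs one_ne_zero
  obtain ⟨L, hL⟩ := hFc.exists_bound_of_continuous hFs.continuous
  have hL' : ∀ w, ‖F w‖ ≤ L.toNNReal := fun w => (hL w).trans (Real.le_coe_toNNReal L)
  obtain ⟨x, hx0, hx⟩ := exists_global_solution_of_lipschitz hK hL' v
  have hin : ∀ w, R ≤ ‖w‖ → inner ℝ (F w) w ≤ 0 := by
    intro w hw
    by_cases h : ‖w‖ ≤ R + δ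
    · rw [real_inner_smul_left]
      exact mul_nonpos_of_nonneg_of_nonpos χ.nonneg (htrap w hw h)
    · have : χ w = 0 := χ.zero_of_le_dist (by rw [dist_zero_right]; exact (not_le.1 h).le)
      simp [F, this]
  refine ⟨x, hx0, fun t ht => ?_⟩
  have hb : ‖x t‖ ≤ R := norm_le_of_inner_field_nonpos hR.le hin (hx0 ▸ hv) hx ht
  have h1 : χ (x t) = 1 := χ.one_of_mem_closedBall (by simpa using hb)
  simpa [F, h1] using hx t ht

lemma TrappingBall.isSolution_flow (htrap : M.TrappingBall R) (hR : 0 < R) (hv : ‖v‖ ≤ R) :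
    M.IsSolution v (fun t => M.flow t v) := by
  have h := htrap.exists_isSolution hR hv
  have : (fun t => M.flow t v) = h.choose := by
    funext t
    simp [flow, h]
  rw [this]
  exact h.choose_spec

variable (M) in
/-- The solution path of the system on `[0, T]`, as a function of the initial value. -/
noncomputable abbrev path {T : ℝ} (hT : 0 ≤ T) (v : EuclideanSpace ℝ (Fin d)) :
    C(Set.Icc (0 : ℝ) T, EuclideanSpace ℝ (Fin d)) :=
  solutionPath M.A M.B M.f hT v

lemma TrappingBall.path_spec (htrap : M.TrappingBall R) (hR : 0 < R) (hv : ‖v‖ ≤ R) {T : ℝ}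
    (hT : 0 ≤ T) : v ∈ solvable M.A M.B M.f hT ∧
      ∀ t : Set.Icc (0 : ℝ) T, M.path hT v t = M.flow t v := by
  obtain ⟨h0, h1⟩ := htrap.isSolution_flow hR hv
  have := mem_solvable_of_hasDerivWithinAt (A := M.A) (B := M.B) (f := M.f) hT
    (x := fun t => M.flow t v) (fun t ht => (h1 t ht.1).mono Set.Icc_subset_Ici_self)
  simpa only [h0] using this

end ObservedSystem

/-! ### The noise functional and its size -/

section Noise

/-- Summation by parts for inner products. -/
lemma sum_inner_by_parts {V : Type*} [NormedAddCommGroup V] [InnerProductSpace ℝ V]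
    (z a : ℕ → V) (k : ℕ) :
    ∑ i ∈ Finset.range (k + 1), inner ℝ (z i) (a i)
      = inner ℝ (∑ l ∈ Finset.range (k + 1), z l) (a k)
        - ∑ i ∈ Finset.range k,
            inner ℝ (∑ l ∈ Finset.range (i + 1), z l) (a (i + 1) - a i) := by
  induction k with
  | zero => simp
  | succ k ih =>
    have h1 := Finset.sum_range_succ
      (fun i => inner ℝ (∑ l ∈ Finset.range (i + 1), z l) (a (i + 1) - a i)) k
    rw [Finset.sum_range_succ, ih, h1, Finset.sum_range_succ z (k + 1), inner_add_left,
      inner_sub_right]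
    ring

variable {m : ℕ} {Ω : Type*} [MeasurableSpace Ω] {σ : ℝ} {P : Measure Ω}
  [IsProbabilityMeasure P] {Z : ℕ → Ω → EuclideanSpace ℝ (Fin m)}

omit [IsProbabilityMeasure P] in
lemma IsGaussianNoise.measurable_apply (hZ : IsGaussianNoise σ P Z) (j : ℕ) (l : Fin m) :
    Measurable fun ω => Z j ω l := by
  have : Continuous fun y : EuclideanSpace ℝ (Fin m) => y l := by fun_prop
  exact this.measurable.comp (hZ.measurable j)

omit [IsProbabilityMeasure P] in
lemma IsGaussianNoise.memLp_apply (hZ : IsGaussianNoise σ P Z) (j : ℕ) (l : Fin m) :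
    MemLp (fun ω => Z j ω l) 2 P := by
  have h := memLp_id_gaussianReal (μ := 0) (v := (σ ^ 2).toNNReal) 2
  rw [← hZ.law j l, memLp_map_measure_iff (by fun_prop)
    (hZ.measurable_apply j l).aemeasurable] at h
  exact h

omit [IsProbabilityMeasure P] in
lemma IsGaussianNoise.variance_apply (hZ : IsGaussianNoise σ P Z) (j : ℕ) (l : Fin m) :
    Var[fun ω => Z j ω l; P] = σ ^ 2 := by
  rw [← variance_id_map (hZ.measurable_apply j l).aemeasurable, hZ.law j l,
    variance_id_gaussianReal, Real.coe_toNNReal _ (sq_nonneg σ)]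

omit [IsProbabilityMeasure P] in
lemma IsGaussianNoise.integral_apply (hZ : IsGaussianNoise σ P Z) (j : ℕ) (l : Fin m) :
    ∫ ω, Z j ω l ∂P = 0 := by
  have h := integral_map (μ := P) (φ := fun ω => Z j ω l) (f := fun x : ℝ => x)
    (hZ.measurable_apply j l).aemeasurable (by fun_prop)
  rw [← h, hZ.law j l, integral_id_gaussianReal]

lemma IsGaussianNoise.integral_sum_apply_sq (hZ : IsGaussianNoise σ P Z) (n : ℕ) (l : Fin m) :
    ∫ ω, (∑ j ∈ Finset.range n, Z j ω l) ^ 2 ∂P = n * σ ^ 2 := by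
  have hmean : ∫ ω, ∑ j ∈ Finset.range n, Z j ω l ∂P = 0 := by
    rw [integral_finsetSum _ fun j _ => (hZ.memLp_apply j l).integrable one_le_two]
    simp [hZ.integral_apply]
  rw [← variance_of_integral_eq_zero
    (Finset.measurable_fun_sum _ fun j _ => hZ.measurable_apply j l).aemeasurable hmean]
  have hfun : (fun ω => ∑ j ∈ Finset.range n, Z j ω l)
      = ∑ j ∈ Finset.range n, fun ω => Z j ω l := by
    funext ω; simp
  rw [hfun, IndepFun.variance_sum (fun j _ => hZ.memLp_apply j l)]
  · simp [hZ.variance_apply]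
  · intro i _ j _ hij
    exact hZ.indep.indepFun (i := (i, l)) (j := (j, l)) (by simpa using hij)

omit [IsProbabilityMeasure P] in
lemma IsGaussianNoise.integrable_sum_apply_sq (hZ : IsGaussianNoise σ P Z) (n : ℕ) (l : Fin m) :
    Integrable (fun ω => (∑ j ∈ Finset.range n, Z j ω l) ^ 2) P :=
  (memLp_finsetSum _ fun j _ => hZ.memLp_apply j l).integrable_sq

lemma norm_sq_sum_eq (z : ℕ → EuclideanSpace ℝ (Fin m)) (n : ℕ) :
    ‖∑ j ∈ Finset.range n, z j‖ ^ 2 = ∑ l, (∑ j ∈ Finset.range n, z j l) ^ 2 := by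
  rw [EuclideanSpace.real_norm_sq_eq]
  simp

omit [IsProbabilityMeasure P] in
lemma IsGaussianNoise.integrable_norm_sum_sq (hZ : IsGaussianNoise σ P Z) (n : ℕ) :
    Integrable (fun ω => ‖∑ j ∈ Finset.range n, Z j ω‖ ^ 2) P := by
  simp_rw [norm_sq_sum_eq]
  exact integrable_finsetSum _ fun l _ => hZ.integrable_sum_apply_sq n l

lemma IsGaussianNoise.integral_norm_sum_sq (hZ : IsGaussianNoise σ P Z) (n : ℕ) :
    ∫ ω, ‖∑ j ∈ Finset.range n, Z j ω‖ ^ 2 ∂P = m * (n * σ ^ 2) := by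
  simp_rw [norm_sq_sum_eq]
  rw [integral_finsetSum _ fun l _ => hZ.integrable_sum_apply_sq n l]
  simp [hZ.integral_sum_apply_sq]

/-- A quadratic measure of the size of the partial sums of `z_0, …, z_k`, scaled by the step
size `h`. -/
noncomputable def noiseSize (h : ℝ) (k : ℕ) (z : ℕ → EuclideanSpace ℝ (Fin m)) : ℝ :=
  h ^ 2 * ‖∑ l ∈ Finset.range (k + 1), z l‖ ^ 2
    + h ^ 3 * ∑ i ∈ Finset.range k, ‖∑ l ∈ Finset.range (i + 1), z l‖ ^ 2

lemma noiseSize_nonneg {h : ℝ} (hh : 0 ≤ h) (k : ℕ) (z : ℕ → EuclideanSpace ℝ (Fin m)) :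
    0 ≤ noiseSize h k z := by
  unfold noiseSize
  positivity

omit [IsProbabilityMeasure P] in
lemma IsGaussianNoise.integrable_noiseSize (hZ : IsGaussianNoise σ P Z) (h : ℝ) (k : ℕ) :
    Integrable (fun ω => noiseSize h k fun j => Z j ω) P :=
  ((hZ.integrable_norm_sum_sq (k + 1)).const_mul _).add
    ((integrable_finsetSum _ fun i _ => hZ.integrable_norm_sum_sq (i + 1)).const_mul _)

omit [IsProbabilityMeasure P] in
lemma IsGaussianNoise.measurable_noiseSize (hZ : IsGaussianNoise σ P Z) (h : ℝ) (k : ℕ) :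
    Measurable (fun ω => noiseSize h k fun j => Z j ω) := by
  have hS : ∀ n, Measurable fun ω => ‖∑ j ∈ Finset.range n, Z j ω‖ ^ 2 := fun n =>
    (Finset.measurable_fun_sum _ fun j _ => hZ.measurable j).norm.pow_const 2
  exact ((hS _).const_mul _).add
    ((Finset.measurable_fun_sum _ fun i _ => hS (i + 1)).const_mul _)

/-- A partial sum of `n` noise vectors has second moment `m n σ²`. The weights `h²` and `h³` make
both contributions of order `σ²h`, because `h²k = hT` and `h³k² = hT²`. -/
lemma IsGaussianNoise.integral_noiseSize_le (hZ : IsGaussianNoise σ P Z) {h T : ℝ} {k : ℕ}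
    (hh : 0 < h) (hT : T = k * h) (hk : 1 ≤ k) :
    ∫ ω, noiseSize h k (fun j => Z j ω) ∂P ≤ 2 * T * (1 + T) * m * (σ * √h) ^ 2 := by
  unfold noiseSize
  rw [integral_add ((hZ.integrable_norm_sum_sq (k + 1)).const_mul _)
    ((integrable_finsetSum _ fun i _ => hZ.integrable_norm_sum_sq (i + 1)).const_mul _),
    integral_const_mul, integral_const_mul,
    integral_finsetSum _ fun i _ => hZ.integrable_norm_sum_sq (i + 1)]
  simp_rw [hZ.integral_norm_sum_sq]
  have hk' : (1 : ℝ) ≤ k := by exact_mod_cast hk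
  have h1 : ∑ i ∈ Finset.range k, (m : ℝ) * (((i + 1 : ℕ) : ℝ) * σ ^ 2)
      ≤ k * (m * (2 * k * σ ^ 2)) := by
    rw [← nsmul_eq_mul]
    refine (Finset.sum_le_card_nsmul _ _ (m * (2 * k * σ ^ 2)) fun i hi => ?_).trans_eq
      (by rw [Finset.card_range])
    have : ((i + 1 : ℕ) : ℝ) ≤ 2 * k := by
      have : i + 1 ≤ k := Finset.mem_range.1 hi
      have : ((i + 1 : ℕ) : ℝ) ≤ k := by exact_mod_cast this
      linarith
    gcongr
  have h2 : ((k + 1 : ℕ) : ℝ) ≤ 2 * k := by push_cast; linarith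
  calc _ ≤ h ^ 2 * (m * (2 * k * σ ^ 2)) + h ^ 3 * (k * (m * (2 * k * σ ^ 2))) := by gcongr
    _ = _ := by rw [mul_pow, Real.sq_sqrt hh.le, hT]; ring

lemma IsGaussianNoise.prob_noiseSize_le (hZ : IsGaussianNoise σ P Z) {h T ε τ : ℝ} {k : ℕ}
    (hh : 0 < h) (hT : T = k * h) (hk : 1 ≤ k) (hτ : 0 < τ)
    (hs : 2 * T * (1 + T) * m * (σ * √h) ^ 2 ≤ ε * τ) :
    ENNReal.ofReal (1 - ε) ≤ P {ω | noiseSize h k (fun j => Z j ω) ≤ τ} := by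
  have hmeas : MeasurableSet {ω | noiseSize h k (fun j => Z j ω) ≤ τ} :=
    measurableSet_le (hZ.measurable_noiseSize h k) measurable_const
  have h1 := mul_meas_ge_le_integral_of_nonneg
    (Filter.Eventually.of_forall fun ω => noiseSize_nonneg hh.le k fun j => Z j ω)
    (hZ.integrable_noiseSize h k) τ
  have h2 : P.real {ω | τ ≤ noiseSize h k (fun j => Z j ω)} ≤ ε := by
    have := h1.trans ((hZ.integral_noiseSize_le hh hT hk).trans hs)
    rw [mul_comm] at this
    exact le_of_mul_le_mul_right this hτ
  have hsub : {ω | noiseSize h k (fun j => Z j ω) ≤ τ}ᶜ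
      ⊆ {ω | τ ≤ noiseSize h k (fun j => Z j ω)} := fun ω hω => by
    rw [Set.mem_compl_iff, Set.mem_ofPred_eq, not_le] at hω
    exact hω.le
  have h3 : P.real {ω | noiseSize h k (fun j => Z j ω) ≤ τ}ᶜ ≤ ε :=
    (measureReal_mono hsub (measure_ne_top P _)).trans h2
  rw [probReal_compl_eq_one_sub hmeas] at h3
  refine ENNReal.ofReal_le_of_le_toReal ?_
  change _ ≤ P.real _
  linarith

variable {d : ℕ} {T : ℝ}

/-- The `i`-th grid point `i h`, as a point of `[0, T]`. -/
noncomputable def gridPoint (hT : 0 ≤ T) (h : ℝ) (i : ℕ) : Set.Icc (0 : ℝ) T :=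
  Set.projIcc 0 T hT (i * h)

lemma coe_gridPoint (hT : 0 ≤ T) {h : ℝ} {k i : ℕ} (hh : 0 < h) (hk : T = k * h) (hi : i ≤ k) :
    (gridPoint hT h i : ℝ) = i * h := by
  have : (i * h) ∈ Set.Icc (0 : ℝ) T := ⟨by positivity, by rw [hk]; gcongr⟩
  rw [gridPoint, Set.projIcc_of_mem hT this]

/-- The linear functional `x ↦ h ∑_{i ≤ k} ⟨z_i, H x(i h)⟩` on paths. -/
noncomputable def noiseFunctional (hT : 0 ≤ T)
    (H : EuclideanSpace ℝ (Fin d) →L[ℝ] EuclideanSpace ℝ (Fin m)) (h : ℝ) (k : ℕ)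
    (z : ℕ → EuclideanSpace ℝ (Fin m)) :
    C(Set.Icc (0 : ℝ) T, EuclideanSpace ℝ (Fin d)) →L[ℝ] ℝ :=
  h • ∑ i ∈ Finset.range (k + 1),
    innerSL ℝ (z i) ∘L H ∘L ContinuousMap.evalCLM ℝ (gridPoint hT h i)

variable {H : EuclideanSpace ℝ (Fin d) →L[ℝ] EuclideanSpace ℝ (Fin m)} {h : ℝ} {k : ℕ}
  {z : ℕ → EuclideanSpace ℝ (Fin m)} {τ : ℝ}

lemma noiseFunctional_apply (hT : 0 ≤ T)
    (x : C(Set.Icc (0 : ℝ) T, EuclideanSpace ℝ (Fin d))) :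
    noiseFunctional hT H h k z x
      = h * ∑ i ∈ Finset.range (k + 1), inner ℝ (z i) (H (x (gridPoint hT h i))) := by
  simp [noiseFunctional]

lemma mul_norm_sum_le_of_noiseSize_le (hh : 0 < h) (hτ : 0 ≤ τ)
    (hz : noiseSize h k z ≤ τ ^ 2) : h * ‖∑ l ∈ Finset.range (k + 1), z l‖ ≤ τ := by
  refine le_of_sq_le_sq ?_ hτ
  refine le_trans ?_ hz
  rw [mul_pow, noiseSize]
  exact le_add_of_nonneg_right (by positivity)

/-- Cauchy–Schwarz over the `k` partial sums; the resulting factor `√T` is weakened to `1 + T`. -/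
lemma mul_sum_norm_le_of_noiseSize_le (hT : 0 ≤ T) (hh : 0 < h) (hk : T = k * h) (hτ : 0 ≤ τ)
    (hz : noiseSize h k z ≤ τ ^ 2) :
    h * ∑ i ∈ Finset.range k, h * ‖∑ l ∈ Finset.range (i + 1), z l‖ ≤ (1 + T) * τ := by
  refine le_of_sq_le_sq ?_ (by positivity)
  have h1 : (∑ i ∈ Finset.range k, ‖∑ l ∈ Finset.range (i + 1), z l‖) ^ 2
      ≤ k * ∑ i ∈ Finset.range k, ‖∑ l ∈ Finset.range (i + 1), z l‖ ^ 2 := by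
    simpa using sq_sum_le_card_mul_sum_sq (s := Finset.range k)
      (f := fun i => ‖∑ l ∈ Finset.range (i + 1), z l‖)
  have h2 : h ^ 3 * ∑ i ∈ Finset.range k, ‖∑ l ∈ Finset.range (i + 1), z l‖ ^ 2 ≤ τ ^ 2 :=
    le_trans (le_add_of_nonneg_left (by positivity)) hz
  rw [← Finset.mul_sum]
  calc _ = h ^ 4 * (∑ i ∈ Finset.range k, ‖∑ l ∈ Finset.range (i + 1), z l‖) ^ 2 := by ring
    _ ≤ h ^ 4 * (k * ∑ i ∈ Finset.range k, ‖∑ l ∈ Finset.range (i + 1), z l‖ ^ 2) := by gcongr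
    _ = T * (h ^ 3 * ∑ i ∈ Finset.range k, ‖∑ l ∈ Finset.range (i + 1), z l‖ ^ 2) := by
      rw [hk]; ring
    _ ≤ (1 + T) ^ 2 * τ ^ 2 := by gcongr; nlinarith
    _ = _ := by ring

lemma abs_noiseFunctional_constMap_le (hT : 0 ≤ T) (hh : 0 < h) (hτ : 0 ≤ τ)
    (hz : noiseSize h k z ≤ τ ^ 2) (v : EuclideanSpace ℝ (Fin d)) :
    |noiseFunctional hT H h k z (constMap _ v)| ≤ ‖H‖ * τ * ‖v‖ := by
  rw [noiseFunctional_apply]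
  simp only [constMap_apply]
  rw [← sum_inner, abs_mul, abs_of_pos hh]
  calc _ ≤ h * (‖∑ l ∈ Finset.range (k + 1), z l‖ * ‖H v‖) := by
        gcongr; exact abs_real_inner_le_norm _ _
    _ = (h * ‖∑ l ∈ Finset.range (k + 1), z l‖) * ‖H v‖ := by ring
    _ ≤ τ * (‖H‖ * ‖v‖) := by
        gcongr
        · exact mul_norm_sum_le_of_noiseSize_le hh hτ hz
        · exact H.le_opNorm v
    _ = _ := by ring

/-- Summation by parts puts the noise into partial sums and leaves increments of a primitive, which
are at most `h‖y‖` over one step. The bound is therefore linear in `‖y‖`, and all randomness sits in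
`noiseSize`. -/
lemma abs_noiseFunctional_volterra_le (hT : 0 ≤ T) (hh : 0 < h) (hk : T = k * h) (hτ : 0 ≤ τ)
    (hz : noiseSize h k z ≤ τ ^ 2) (y : C(Set.Icc (0 : ℝ) T, EuclideanSpace ℝ (Fin d))) :
    |noiseFunctional hT H h k z (volterra hT y)| ≤ ‖H‖ * (1 + 2 * T) * τ * ‖y‖ := by
  rw [noiseFunctional_apply, sum_inner_by_parts, mul_sub]
  have h1 : |h * inner ℝ (∑ l ∈ Finset.range (k + 1), z l)
      (H (volterra hT y (gridPoint hT h k)))| ≤ τ * (‖H‖ * (‖y‖ * T)) := by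
    rw [abs_mul, abs_of_pos hh]
    calc _ ≤ h * (‖∑ l ∈ Finset.range (k + 1), z l‖ * ‖H (volterra hT y (gridPoint hT h k))‖) := by
          gcongr; exact abs_real_inner_le_norm _ _
      _ = (h * ‖∑ l ∈ Finset.range (k + 1), z l‖) * ‖H (volterra hT y (gridPoint hT h k))‖ := by
          ring
      _ ≤ _ := by
          gcongr
          · exact mul_norm_sum_le_of_noiseSize_le hh hτ hz
          · refine (H.le_opNorm _).trans ?_
            gcongr
            exact norm_volterra_apply_le hT y _
  have h2 : |h * ∑ i ∈ Finset.range k, inner ℝ (∑ l ∈ Finset.range (i + 1), z l)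
      (H (volterra hT y (gridPoint hT h (i + 1))) - H (volterra hT y (gridPoint hT h i)))|
      ≤ ‖H‖ * ‖y‖ * ((1 + T) * τ) := by
    rw [abs_mul, abs_of_pos hh]
    calc _ ≤ h * ∑ i ∈ Finset.range k, (‖H‖ * ‖y‖) * (h * ‖∑ l ∈ Finset.range (i + 1), z l‖) := by
          gcongr
          refine (Finset.abs_sum_le_sum_abs _ _).trans (Finset.sum_le_sum fun i hi => ?_)
          have hi' : i + 1 ≤ k := Finset.mem_range.1 hi
          refine (abs_real_inner_le_norm _ _).trans ?_
          rw [← map_sub]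
          have h3 := norm_volterra_sub_le hT y (gridPoint hT h i) (gridPoint hT h (i + 1))
          rw [coe_gridPoint hT hh hk hi', coe_gridPoint hT hh hk (by omega : i ≤ k)] at h3
          have h4 : |((i + 1 : ℕ) : ℝ) * h - i * h| = h := by
            rw [← sub_mul]; push_cast; rw [add_sub_cancel_left, one_mul, abs_of_pos hh]
          rw [h4] at h3
          calc _ ≤ ‖∑ l ∈ Finset.range (i + 1), z l‖ * (‖H‖ * (‖y‖ * h)) := by
                gcongr
                refine (H.le_opNorm _).trans ?_
                gcongr
            _ = _ := by ring
      _ = ‖H‖ * ‖y‖ * (h * ∑ i ∈ Finset.range k, h * ‖∑ l ∈ Finset.range (i + 1), z l‖) := by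
          rw [← Finset.mul_sum]; ring
      _ ≤ _ := by
          exact mul_le_mul_of_nonneg_left (mul_sum_norm_le_of_noiseSize_le hT hh hk hτ hz)
            (by positivity)
  refine (abs_sub _ _).trans ((add_le_add h1 h2).trans_eq ?_)
  ring

end Noise

/-! ### Second derivatives and quadratic growth -/

section SecondDerivative

set_option maxSynthPendingDepth 3

variable {E F : Type*} [NormedAddCommGroup E] [NormedSpace ℝ E] [NormedAddCommGroup F]
  [NormedSpace ℝ F]

lemma norm_fderiv_fderiv (g : E → F) (x : E) :
    ‖fderiv ℝ (fderiv ℝ g) x‖ = ‖iteratedFDeriv ℝ 2 g x‖ := by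
  rw [← norm_iteratedFDeriv_fderiv, ← norm_iteratedFDeriv_one]

lemma norm_fderiv_fderiv_fderiv (g : E → F) (x : E) :
    ‖fderiv ℝ (fderiv ℝ (fderiv ℝ g)) x‖ = ‖iteratedFDeriv ℝ 3 g x‖ := by
  rw [norm_fderiv_fderiv, norm_iteratedFDeriv_fderiv]

lemma abs_fderiv_fderiv_apply_le (g : E → ℝ) (x w : E) :
    |fderiv ℝ (fderiv ℝ g) x w w| ≤ ‖iteratedFDeriv ℝ 2 g x‖ * ‖w‖ ^ 2 := by
  rw [← norm_fderiv_fderiv]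
  refine ((fderiv ℝ (fderiv ℝ g) x).le_opNorm₂ w w).trans_eq (by ring)

/-- The second derivative varies by at most the bound on the third derivative times the
distance. -/
lemma norm_fderiv_fderiv_sub_le {g : E → ℝ} {s : Set E} (hs : Convex ℝ s) (ho : IsOpen s)
    (hg : ContDiffOn ℝ 3 g s) {C : ℝ} (hC : ∀ x ∈ s, ‖iteratedFDeriv ℝ 3 g x‖ ≤ C) {x y : E}
    (hx : x ∈ s) (hy : y ∈ s) :
    ‖fderiv ℝ (fderiv ℝ g) y - fderiv ℝ (fderiv ℝ g) x‖ ≤ C * ‖y - x‖ := by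
  refine hs.norm_image_sub_le_of_norm_fderiv_le (𝕜 := ℝ) (fun z hz => ?_) (fun z hz => ?_) hx hy
  · have h1 : ContDiffAt ℝ 3 g z := hg.contDiffAt (ho.mem_nhds hz)
    have h2 : ContDiffAt ℝ 2 (fderiv ℝ g) z := h1.fderiv_right (by norm_num)
    have h3 : ContDiffAt ℝ 1 (fderiv ℝ (fderiv ℝ g)) z := h2.fderiv_right (by norm_num)
    exact h3.differentiableAt (by norm_num)
  · rw [norm_fderiv_fderiv_fderiv]
    exact hC z hz

/-- A function that lies above a quadratic touching it at `u` has a second derivative at `u`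
that is at least that of the quadratic. -/
lemma le_fderiv_fderiv_of_quadratic_le {φ : E → ℝ} {u : E} {c : ℝ} (hφ : ContDiffAt ℝ 2 φ u)
    (h0 : φ u = 0) (hle : ∀ᶠ v in nhds u, c / 2 * ‖v - u‖ ^ 2 ≤ φ v) (w : E) :
    c * ‖w‖ ^ 2 ≤ fderiv ℝ (fderiv ℝ φ) u w w := by
  set f : ℝ → ℝ := fun t => φ (u + t • w) - c / 2 * ‖w‖ ^ 2 * t ^ 2 with hf
  have hline : ∀ t : ℝ, HasDerivAt (fun t : ℝ => u + t • w) w t := fun t => by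
    simpa using ((hasDerivAt_id t).smul_const w).const_add u
  have htend : Filter.Tendsto (fun t : ℝ => u + t • w) (nhds 0) (nhds u) := by
    have : Continuous fun t : ℝ => u + t • w := by fun_prop
    simpa using this.tendsto 0
  have hdiff : ∀ᶠ v in nhds u, DifferentiableAt ℝ φ v := by
    filter_upwards [hφ.eventually (by norm_num)] with v hv
    exact hv.differentiableAt (by norm_num)
  have hquad : ∀ t : ℝ, HasDerivAt (fun t : ℝ => c / 2 * ‖w‖ ^ 2 * t ^ 2) (c * ‖w‖ ^ 2 * t) t :=
    fun t => by
    refine ((hasDerivAt_pow 2 t).const_mul (c / 2 * ‖w‖ ^ 2)).congr_deriv ?_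
    norm_num
    ring
  have hd1 : deriv f =ᶠ[nhds 0] fun t => fderiv ℝ φ (u + t • w) w - c * ‖w‖ ^ 2 * t := by
    filter_upwards [htend.eventually hdiff] with t ht
    have h1 : HasDerivAt (fun t : ℝ => φ (u + t • w)) (fderiv ℝ φ (u + t • w) w) t :=
      ht.hasFDerivAt.comp_hasDerivAt t (hline t)
    exact (h1.sub (hquad t)).deriv
  have hd2 : deriv (deriv f) 0 = fderiv ℝ (fderiv ℝ φ) u w w - c * ‖w‖ ^ 2 := by
    rw [hd1.deriv_eq]
    have h1 : DifferentiableAt ℝ (fderiv ℝ φ) (u + (0 : ℝ) • w) := by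
      rw [zero_smul, add_zero]
      exact (hφ.fderiv_right (m := 1) (by norm_num)).differentiableAt (by norm_num)
    have h2 : HasDerivAt (fun t : ℝ => fderiv ℝ φ (u + t • w))
        (fderiv ℝ (fderiv ℝ φ) (u + (0 : ℝ) • w) w) 0 :=
      h1.hasFDerivAt.comp_hasDerivAt 0 (hline 0)
    have h3 : HasDerivAt (fun t : ℝ => fderiv ℝ φ (u + t • w) w)
        (fderiv ℝ (fderiv ℝ φ) (u + (0 : ℝ) • w) w w) 0 := by
      simpa using h2.clm_apply (hasDerivAt_const 0 w)
    rw [zero_smul, add_zero] at h3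
    refine (h3.sub ((hasDerivAt_id (0 : ℝ)).const_mul (c * ‖w‖ ^ 2))).deriv.trans ?_
    rw [mul_one]
  have hf0 : f 0 = 0 := by simp [hf, h0]
  have hnonneg : ∀ᶠ t in nhds (0 : ℝ), 0 ≤ f t := by
    filter_upwards [htend.eventually hle] with t ht
    rw [add_sub_cancel_left, norm_smul, mul_pow, Real.norm_eq_abs, sq_abs] at ht
    simp only [hf]
    linarith
  have hmin : IsLocalMin f 0 := hnonneg.mono fun t ht => hf0.trans_le ht
  have hdf : deriv f 0 = 0 := hmin.deriv_eq_zero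
  by_contra! hneg
  have hcont : ContinuousAt f 0 := by
    refine ContinuousAt.sub ?_ (by fun_prop)
    exact ContinuousAt.comp (g := φ) (by simpa using hφ.continuousAt) (by fun_prop)
  -- If `f''(0) < 0`, then 0 is a local maximum as well as a local minimum of `f`; hence `f` is
  -- locally constant and `f''(0) = 0`, a contradiction.
  have hmin' : IsLocalMin (fun t => -f t) 0 := by
    refine isLocalMin_of_deriv_deriv_pos ?_ (by simp [hdf]) hcont.neg
    simp only [deriv.fun_neg', deriv.fun_neg]
    rw [hd2]
    linarith
  have hzero : f =ᶠ[nhds 0] fun _ => 0 := by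
    filter_upwards [hnonneg, hmin'] with t h1 h2
    simp only [hf0] at h2
    linarith
  have : deriv (deriv f) 0 = 0 := by
    rw [(hzero.deriv).deriv_eq]
    simp
  linarith

end SecondDerivative

/-! ### Quadratic convergence of Newton's method -/

section Newton

/-- One step of Newton's method for the equation `F = 0`. -/
lemma norm_newton_step_sub_le {E : Type*} [NormedAddCommGroup E] [NormedSpace ℝ E] {F : E → E}
    {s : Set E} (hs : Convex ℝ s) (hF : ∀ x ∈ s, DifferentiableAt ℝ F x) {κ L : ℝ} (hκ : 0 < κ)
    (hL0 : 0 ≤ L) (hL : ∀ x ∈ s, ∀ y ∈ s, ‖fderiv ℝ F y - fderiv ℝ F x‖ ≤ L * ‖y - x‖)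
    {x a : E} (hx : x ∈ s) (ha : a ∈ s) (hFa : F a = 0) (hinv : (fderiv ℝ F x).IsInvertible)
    (hlow : ∀ w, κ * ‖w‖ ≤ ‖fderiv ℝ F x w‖) :
    ‖x - (fderiv ℝ F x).inverse (F x) - a‖ ≤ L / κ * ‖x - a‖ ^ 2 := by
  obtain ⟨e, he⟩ := hinv
  have h1 : fderiv ℝ F x (x - (fderiv ℝ F x).inverse (F x) - a)
      = F a - F x - fderiv ℝ F x (a - x) := by
    rw [hFa, ← he, ContinuousLinearMap.inverse_equiv]
    simp
    abel
  have h2 : ‖F a - F x - fderiv ℝ F x (a - x)‖ ≤ L * ‖a - x‖ * ‖a - x‖ := by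
    -- On this smaller convex set the derivative differs from that at `x` by at most `L‖a - x‖`, so
    -- the mean value inequality gives a quadratic remainder.
    refine (hs.inter (convex_closedBall x ‖a - x‖)).norm_image_sub_le_of_norm_fderiv_le'
      (𝕜 := ℝ) (fun y hy => hF y hy.1) (fun y hy => ?_) ⟨hx, by simp⟩
      ⟨ha, by simp [dist_eq_norm]⟩
    refine (hL x hx y hy.1).trans ?_
    gcongr
    simpa [dist_eq_norm] using hy.2
  have h3 := (hlow _).trans (h1 ▸ h2)
  rw [norm_sub_rev a x] at h3
  rw [div_mul_eq_mul_div, le_div_iff₀ hκ]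
  linarith

variable {d : ℕ}

/-- The Riesz identification of the dual of a Euclidean space, as a linear map. -/
noncomputable def rieszMap : (EuclideanSpace ℝ (Fin d) →L[ℝ] ℝ) →ₗᵢ[ℝ] EuclideanSpace ℝ (Fin d) where
  toFun := (InnerProductSpace.toDual ℝ (EuclideanSpace ℝ (Fin d))).symm
  map_add' := map_add _
  map_smul' r l := by simp
  norm_map' := (InnerProductSpace.toDual ℝ (EuclideanSpace ℝ (Fin d))).symm.norm_map

lemma inner_rieszMap (l : EuclideanSpace ℝ (Fin d) →L[ℝ] ℝ) (w : EuclideanSpace ℝ (Fin d)) :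
    inner ℝ (rieszMap l) w = l w := InnerProductSpace.toDual_symm_apply

variable {g : EuclideanSpace ℝ (Fin d) → ℝ} {x : EuclideanSpace ℝ (Fin d)}

lemma gradient_eq_rieszMap : gradient g = fun x => rieszMap (fderiv ℝ g x) := rfl

lemma hasFDerivAt_gradient (hg : ContDiffAt ℝ 2 g x) :
    HasFDerivAt (gradient g) (rieszMap.toContinuousLinearMap ∘L fderiv ℝ (fderiv ℝ g) x) x :=
  rieszMap.toContinuousLinearMap.hasFDerivAt.comp x
    ((hg.fderiv_right (m := 1) (by norm_num)).differentiableAt (by norm_num)).hasFDerivAt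

lemma hessian_eq (hg : ContDiffAt ℝ 2 g x) :
    hessian g x = rieszMap.toContinuousLinearMap ∘L fderiv ℝ (fderiv ℝ g) x :=
  (hasFDerivAt_gradient hg).fderiv

lemma mul_norm_le_hessian (hg : ContDiffAt ℝ 2 g x) {κ : ℝ}
    (hκ : ∀ w, κ * ‖w‖ ^ 2 ≤ fderiv ℝ (fderiv ℝ g) x w w) (w : EuclideanSpace ℝ (Fin d)) :
    κ * ‖w‖ ≤ ‖hessian g x w‖ := by
  rcases eq_or_ne w 0 with rfl | hw
  · simp
  have h1 : κ * ‖w‖ ^ 2 ≤ ‖hessian g x w‖ * ‖w‖ := by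
    refine (hκ w).trans (le_trans (le_of_eq ?_) (real_inner_le_norm _ _))
    rw [hessian_eq hg]
    exact (inner_rieszMap _ _).symm
  have h2 : 0 < ‖w‖ := norm_pos_iff.2 hw
  rw [sq, ← mul_assoc] at h1
  exact le_of_mul_le_mul_right h1 h2

lemma ContinuousLinearMap.isInvertible_of_mul_norm_le {E : Type*} [NormedAddCommGroup E]
    [NormedSpace ℝ E] [FiniteDimensional ℝ E] {l : E →L[ℝ] E} {κ : ℝ} (hκ : 0 < κ)
    (hl : ∀ w, κ * ‖w‖ ≤ ‖l w‖) : l.IsInvertible := by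
  have hinj : Function.Injective l.toLinearMap := by
    rw [injective_iff_map_eq_zero]
    intro w hw
    have := hl w
    rw [show l w = 0 from hw, norm_zero] at this
    exact norm_le_zero_iff.1 (nonpos_of_mul_nonpos_right this hκ)
  exact ⟨(LinearEquiv.ofInjectiveEndo _ hinj).toContinuousLinearEquiv, by ext; rfl⟩

/-- Quadratic convergence of Newton's method near a critical point, in a ball where the function
is strongly convex with bounded third derivative. -/
theorem newton_convergence {u a x₀ : EuclideanSpace ℝ (Fin d)} {r κ N D : ℝ} (hκ : 0 < κ)
    (hN : 0 < N) (hg : ContDiffOn ℝ 3 g (Metric.ball u r))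
    (hlow : ∀ x ∈ Metric.ball u r, ∀ w, κ * ‖w‖ ^ 2 ≤ fderiv ℝ (fderiv ℝ g) x w w)
    (hthird : ∀ x ∈ Metric.ball u r, ‖iteratedFDeriv ℝ 3 g x‖ ≤ κ / N)
    (hcrit : fderiv ℝ g a = 0) (hau : ‖a - u‖ < D) (hx₀ : ‖x₀ - u‖ < D) (hDr : 3 * D ≤ r)
    (hDN : 2 * D ≤ N) :
    ‖x₀ - a‖ < N ∧ ∀ i, newtonIterate g x₀ i ∈ Metric.ball u r ∧
      ContDiffAt ℝ 2 g (newtonIterate g x₀ i) ∧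
      (hessian g (newtonIterate g x₀ i)).IsInvertible ∧
      ‖newtonIterate g x₀ i - a‖ ≤ N * (‖x₀ - a‖ / N) ^ (2 ^ i) := by
  have hD : 0 < D := (norm_nonneg _).trans_lt hau
  have hx₀a : ‖x₀ - a‖ < 2 * D := by
    have := norm_sub_le_norm_sub_add_norm_sub x₀ u a
    rw [norm_sub_rev u a] at this
    linarith
  have hC2 : ∀ x ∈ Metric.ball u r, ContDiffAt ℝ 2 g x := fun x hx =>
    (hg.contDiffAt (Metric.isOpen_ball.mem_nhds hx)).of_le (by norm_num)
  have hinv : ∀ x ∈ Metric.ball u r, (hessian g x).IsInvertible := fun x hx =>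
    ContinuousLinearMap.isInvertible_of_mul_norm_le hκ
      (mul_norm_le_hessian (hC2 x hx) (hlow x hx))
  have ha : a ∈ Metric.ball u r := by
    rw [Metric.mem_ball, dist_eq_norm]; linarith
  -- The distance `2D` to `a` plus the distance `D` from `a` to `u` is the reason for requiring `3 *
  -- D ≤ r`.
  have hball : ∀ x, ‖x - a‖ < 2 * D → x ∈ Metric.ball u r := fun x hx => by
    rw [Metric.mem_ball, dist_eq_norm]
    linarith [norm_sub_le_norm_sub_add_norm_sub x a u]
  have hstep : ∀ x ∈ Metric.ball u r,
      ‖x - (hessian g x).inverse (gradient g x) - a‖ ≤ ‖x - a‖ ^ 2 / N := by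
    intro x hx
    have := norm_newton_step_sub_le (F := gradient g) (convex_ball u r)
      (fun y hy => (hasFDerivAt_gradient (hC2 y hy)).differentiableAt) hκ
      (by positivity : 0 ≤ κ / N) (fun y hy z hz => ?_) hx ha ?_ (hinv x hx)
      (mul_norm_le_hessian (hC2 x hx) (hlow x hx))
    · refine this.trans_eq ?_
      field_simp
    · change ‖hessian g z - hessian g y‖ ≤ _
      rw [hessian_eq (hC2 y hy), hessian_eq (hC2 z hz), ← ContinuousLinearMap.comp_sub]
      refine (ContinuousLinearMap.opNorm_comp_le _ _).trans ?_
      refine (mul_le_of_le_one_left (norm_nonneg _)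
        (LinearIsometry.norm_toContinuousLinearMap_le _)).trans ?_
      exact norm_fderiv_fderiv_sub_le (convex_ball u r) Metric.isOpen_ball hg hthird hy hz
    · simp only [gradient_eq_rieszMap, hcrit, map_zero]
  have hρ0 : 0 ≤ ‖x₀ - a‖ / N := by positivity
  have hρ1 : ‖x₀ - a‖ / N ≤ 1 := (div_le_one hN).2 (by linarith)
  -- The rate implies that the iterate is no farther from `a` than `x₀`, so one induction gives both
  -- well-definedness and convergence.
  have hrate : ∀ i, ‖newtonIterate g x₀ i - a‖ ≤ N * (‖x₀ - a‖ / N) ^ (2 ^ i) →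
      newtonIterate g x₀ i ∈ Metric.ball u r := by
    intro i hi
    refine hball _ (lt_of_le_of_lt (hi.trans ?_) hx₀a)
    calc N * (‖x₀ - a‖ / N) ^ (2 ^ i) ≤ N * (‖x₀ - a‖ / N) := by
          gcongr
          exact pow_le_of_le_one hρ0 hρ1 (by positivity)
      _ = ‖x₀ - a‖ := by field_simp
  have hind : ∀ i, ‖newtonIterate g x₀ i - a‖ ≤ N * (‖x₀ - a‖ / N) ^ (2 ^ i) := by
    intro i
    induction i with
    | zero => simp [newtonIterate]; field_simp; rfl
    | succ i ih =>
      refine (hstep _ (hrate i ih)).trans ?_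
      calc ‖newtonIterate g x₀ i - a‖ ^ 2 / N
          ≤ (N * (‖x₀ - a‖ / N) ^ (2 ^ i)) ^ 2 / N := by gcongr
        _ = _ := by rw [pow_succ 2 i, pow_mul]; field_simp
  exact ⟨by linarith, fun i => ⟨hrate i (hind i), hC2 _ (hrate i (hind i)),
    hinv _ (hrate i (hind i)), hind i⟩⟩

end Newton

/-! ### Small perturbations of a nondegenerate minimum -/

section Perturbation

set_option maxSynthPendingDepth 3

variable {d : ℕ} {g φ p : EuclideanSpace ℝ (Fin d) → ℝ} {u : EuclideanSpace ℝ (Fin d)}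
  {R c C s b N r D : ℝ}

/-- The identity is stated on a neighbourhood so that it can be differentiated again. -/
lemma fderiv_eventuallyEq_of_mul_eq_add {x : EuclideanSpace ℝ (Fin d)} (hs : 0 < s)
    (hφ : ContDiffOn ℝ 3 φ (Metric.ball 0 R)) (hp : ContDiffOn ℝ 3 p (Metric.ball 0 R))
    (hg : ∀ v ∈ Metric.ball 0 R, s * g v = φ v + p v + b) (hx : x ∈ Metric.ball 0 R) :
    fderiv ℝ g =ᶠ[nhds x] fun y => s⁻¹ • (fderiv ℝ φ y + fderiv ℝ p y) := by
  filter_upwards [Metric.isOpen_ball.mem_nhds hx] with y hy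
  have hφy := ((hφ.contDiffAt (Metric.isOpen_ball.mem_nhds hy)).differentiableAt
    (by norm_num)).hasFDerivAt
  have hpy := ((hp.contDiffAt (Metric.isOpen_ball.mem_nhds hy)).differentiableAt
    (by norm_num)).hasFDerivAt
  have heq : g =ᶠ[nhds y] fun v => s⁻¹ • (φ v + p v + b) := by
    filter_upwards [Metric.isOpen_ball.mem_nhds hy] with v hv
    rw [← hg v hv, smul_eq_mul, inv_mul_cancel_left₀ hs.ne']
  rw [heq.fderiv_eq]
  exact (((hφy.add hpy).add_const b).const_smul s⁻¹).fderiv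

lemma contDiffOn_of_mul_eq_add (hs : 0 < s)
    (hφ : ContDiffOn ℝ 3 φ (Metric.ball 0 R)) (hp : ContDiffOn ℝ 3 p (Metric.ball 0 R))
    (hg : ∀ v ∈ Metric.ball 0 R, s * g v = φ v + p v + b) :
    ContDiffOn ℝ 3 g (Metric.ball 0 R) := by
  refine ContDiffOn.congr (f := fun v => s⁻¹ * (φ v + p v + b))
    (contDiffOn_const.mul ((hφ.add hp).add contDiffOn_const)) fun v hv => ?_
  rw [← hg v hv, inv_mul_cancel_left₀ hs.ne']

lemma fderiv_fderiv_of_mul_eq_add {x : EuclideanSpace ℝ (Fin d)} (hs : 0 < s)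
    (hφ : ContDiffOn ℝ 3 φ (Metric.ball 0 R)) (hp : ContDiffOn ℝ 3 p (Metric.ball 0 R))
    (hg : ∀ v ∈ Metric.ball 0 R, s * g v = φ v + p v + b) (hx : x ∈ Metric.ball 0 R) :
    fderiv ℝ (fderiv ℝ g) x
      = s⁻¹ • (fderiv ℝ (fderiv ℝ φ) x + fderiv ℝ (fderiv ℝ p) x) := by
  rw [(fderiv_eventuallyEq_of_mul_eq_add hs hφ hp hg hx).fderiv_eq]
  have hφx := (((hφ.contDiffAt (Metric.isOpen_ball.mem_nhds hx)).fderiv_right (m := 2)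
    (by norm_num)).differentiableAt (by norm_num)).hasFDerivAt
  have hpx := (((hp.contDiffAt (Metric.isOpen_ball.mem_nhds hx)).fderiv_right (m := 2)
    (by norm_num)).differentiableAt (by norm_num)).hasFDerivAt
  exact ((hφx.add hpx).const_smul s⁻¹).fderiv

lemma norm_iteratedFDeriv_three_of_mul_eq_add {x : EuclideanSpace ℝ (Fin d)} (hs : 0 < s)
    (hφ : ContDiffOn ℝ 3 φ (Metric.ball 0 R)) (hp : ContDiffOn ℝ 3 p (Metric.ball 0 R))
    (hg : ∀ v ∈ Metric.ball 0 R, s * g v = φ v + p v + b) (hx : x ∈ Metric.ball 0 R) :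
    ‖iteratedFDeriv ℝ 3 g x‖
      ≤ s⁻¹ * (‖iteratedFDeriv ℝ 3 φ x‖ + ‖iteratedFDeriv ℝ 3 p x‖) := by
  simp only [← norm_fderiv_fderiv_fderiv]
  have heq : fderiv ℝ (fderiv ℝ g) =ᶠ[nhds x] fun y =>
      s⁻¹ • (fderiv ℝ (fderiv ℝ φ) y + fderiv ℝ (fderiv ℝ p) y) := by
    filter_upwards [Metric.isOpen_ball.mem_nhds hx] with y hy
    exact fderiv_fderiv_of_mul_eq_add hs hφ hp hg hy
  have hφx := ((((hφ.contDiffAt (Metric.isOpen_ball.mem_nhds hx)).fderiv_right (m := 2)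
    (by norm_num)).fderiv_right (m := 1) (by norm_num)).differentiableAt
    (by norm_num)).hasFDerivAt
  have hpx := ((((hp.contDiffAt (Metric.isOpen_ball.mem_nhds hx)).fderiv_right (m := 2)
    (by norm_num)).fderiv_right (m := 1) (by norm_num)).differentiableAt
    (by norm_num)).hasFDerivAt
  rw [heq.fderiv_eq]
  refine (congrArg norm ((hφx.add hpx).const_smul s⁻¹).fderiv).trans_le ?_
  rw [norm_smul, Real.norm_of_nonneg (by positivity)]
  gcongr
  exact norm_add_le _ _

/-- Newton's method converges quadratically to the minimizers of a function that is, up to scaling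
and an additive constant, a small perturbation of a function with a nondegenerate minimum. -/
theorem newton_convergence_of_perturbation (hc : 0 < c) (hC : 0 ≤ C) (hs : 0 < s)
    (hφ : ContDiffOn ℝ 3 φ (Metric.ball 0 R)) (hp : ContDiffOn ℝ 3 p (Metric.ball 0 R))
    (hg : ∀ v ∈ Metric.closedBall 0 R, s * g v = φ v + p v + b)
    (hφ0 : φ u = 0) (hφlow : ∀ v ∈ Metric.closedBall 0 R, c / 2 * ‖v - u‖ ^ 2 ≤ φ v)
    (hφ3 : ∀ v ∈ Metric.ball 0 R, ‖iteratedFDeriv ℝ 3 φ v‖ ≤ C)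
    (hp0 : ∀ v ∈ Metric.closedBall 0 R, |p v| ≤ c * D ^ 2 / 8)
    (hp2 : ∀ v ∈ Metric.ball 0 R, ‖iteratedFDeriv ℝ 2 p v‖ ≤ c / 4)
    (hp3 : ∀ v ∈ Metric.ball 0 R, ‖iteratedFDeriv ℝ 3 p v‖ ≤ 1)
    (hN : N = c / 4 / (C + 1)) (hrR : r ≤ R - ‖u‖) (hr : r ≤ c / (2 * (C + 1)))
    (hD : 0 < D) (hDN : 2 * D ≤ N) (hDr : 3 * D ≤ r)
    {x₀ a : EuclideanSpace ℝ (Fin d)} (hx₀ : ‖x₀ - u‖ < D)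
    (ha : a ∈ Metric.closedBall 0 R) (hmin : IsMinOn g (Metric.closedBall 0 R) a) :
    NewtonWellDefined R g x₀ ∧ ‖x₀ - a‖ < N ∧
      ∀ i, ‖newtonIterate g x₀ i - a‖ ≤ N * (‖x₀ - a‖ / N) ^ (2 ^ i) := by
  have hsub : Metric.ball u r ⊆ Metric.ball 0 R :=
    Metric.ball_subset_ball' (by rw [dist_zero_right]; linarith)
  have hr0 : 0 < r := by linarith
  have hgb : ∀ v ∈ Metric.ball 0 R, s * g v = φ v + p v + b := fun v hv =>
    hg v (Metric.ball_subset_closedBall hv)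
  have hub : u ∈ Metric.ball u r := Metric.mem_ball_self hr0
  have hu : u ∈ Metric.ball (0 : EuclideanSpace ℝ (Fin d)) R := hsub hub
  have huc := Metric.ball_subset_closedBall hu
  -- From `g a ≤ g u` and `φ u = 0`, `(c/2)‖a - u‖² ≤ p u - p a ≤ cD²/4`. With `D < r ≤ R - ‖u‖`,
  -- this also makes `a` an interior point, hence critical.
  have hau : ‖a - u‖ < D := by
    have h1 : s * g a ≤ s * g u := mul_le_mul_of_nonneg_left (hmin huc) hs.le
    rw [hg a ha, hg u huc, hφ0] at h1
    have h2 := hφlow a ha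
    have h3 := abs_le.1 (hp0 a ha)
    have h4 := abs_le.1 (hp0 u huc)
    refine lt_of_pow_lt_pow_left₀ 2 hD.le ?_
    have h5 : 0 < c * D ^ 2 := by positivity
    have h6 : c * ‖a - u‖ ^ 2 < c * D ^ 2 := by linarith [h3.1, h4.2]
    exact lt_of_mul_lt_mul_left h6 hc.le
  have haball : a ∈ Metric.ball (0 : EuclideanSpace ℝ (Fin d)) R := hsub (by
    rw [Metric.mem_ball, dist_eq_norm]; linarith)
  have hcrit : fderiv ℝ g a = 0 := by
    refine (hmin.isLocalMin ?_).fderiv_eq_zero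
    exact Filter.mem_of_superset (Metric.isOpen_ball.mem_nhds haball)
      Metric.ball_subset_closedBall
  -- The second derivative of `φ` is at least `c` at `u`. Moving to `x` costs at most `c/2` and `p`
  -- costs at most `c/4`, which leaves `c/4`, divided by `s`.
  have hlow : ∀ x ∈ Metric.ball u r, ∀ w,
      c / 4 / s * ‖w‖ ^ 2 ≤ fderiv ℝ (fderiv ℝ g) x w w := by
    intro x hx w
    rw [fderiv_fderiv_of_mul_eq_add hs hφ hp hgb (hsub hx)]
    have h1 : c * ‖w‖ ^ 2 ≤ fderiv ℝ (fderiv ℝ φ) u w w := by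
      refine le_fderiv_fderiv_of_quadratic_le
        ((hφ.contDiffAt (Metric.isOpen_ball.mem_nhds hu)).of_le (by norm_num)) hφ0 ?_ w
      filter_upwards [Metric.isOpen_ball.mem_nhds hu] with v hv
      exact hφlow v (Metric.ball_subset_closedBall hv)
    have h2 := abs_fderiv_fderiv_apply_le p x w
    have h3 : ‖iteratedFDeriv ℝ 2 p x‖ * ‖w‖ ^ 2 ≤ c / 4 * ‖w‖ ^ 2 := by
      gcongr; exact hp2 x (hsub hx)
    have h4 : |(fderiv ℝ (fderiv ℝ φ) x - fderiv ℝ (fderiv ℝ φ) u) w w|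
        ≤ c / 2 * ‖w‖ ^ 2 := by
      have h5 := norm_fderiv_fderiv_sub_le (convex_ball 0 R) Metric.isOpen_ball hφ hφ3 hu
        (hsub hx)
      have h6 : C * ‖x - u‖ ≤ c / 2 := by
        have h7 : ‖x - u‖ ≤ c / (2 * (C + 1)) := by
          rw [← dist_eq_norm]; exact (Metric.mem_ball.1 hx).le.trans hr
        calc C * ‖x - u‖ ≤ (C + 1) * (c / (2 * (C + 1))) := by gcongr; linarith
          _ = c / 2 := by field_simp
      refine ((ContinuousLinearMap.le_opNorm₂ _ w w).trans_eq (by ring)).trans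
        (mul_le_mul_of_nonneg_right (h5.trans h6) (sq_nonneg ‖w‖))
    have h5 : (fderiv ℝ (fderiv ℝ φ) x - fderiv ℝ (fderiv ℝ φ) u) w w
        = fderiv ℝ (fderiv ℝ φ) x w w - fderiv ℝ (fderiv ℝ φ) u w w := rfl
    have h6 : (s⁻¹ • (fderiv ℝ (fderiv ℝ φ) x + fderiv ℝ (fderiv ℝ p) x)) w w
        = (fderiv ℝ (fderiv ℝ φ) x w w + fderiv ℝ (fderiv ℝ p) x w w) / s := by
      rw [div_eq_inv_mul]; rfl
    rw [h6, div_mul_eq_mul_div]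
    gcongr
    rw [h5] at h4
    linarith [(abs_le.1 h4).1, (abs_le.1 (h2.trans h3)).1]
  have hN0 : 0 < N := by rw [hN]; positivity
  have hthird : ∀ x ∈ Metric.ball u r, ‖iteratedFDeriv ℝ 3 g x‖ ≤ c / 4 / s / N := by
    intro x hx
    refine (norm_iteratedFDeriv_three_of_mul_eq_add hs hφ hp hgb (hsub hx)).trans ?_
    -- Here the scale `s` cancels: `N` is the ratio of the convexity constant to the bound on the
    -- third derivative.
    have : c / 4 / s / N = s⁻¹ * (C + 1) := by rw [hN]; field_simp
    rw [this]
    gcongr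
    · exact hφ3 x (hsub hx)
    · exact hp3 x (hsub hx)
  obtain ⟨h1, h2⟩ := newton_convergence (by positivity) hN0
    ((contDiffOn_of_mul_eq_add hs hφ hp hgb).mono hsub) hlow hthird hcrit hau hx₀ hDr hDN
  exact ⟨fun i => ⟨hsub (h2 i).1, (h2 i).2.1, (h2 i).2.2.1⟩, h1, fun i => (h2 i).2.2.2⟩

end Perturbation

/-! ### The smoothing density and its maximizers -/

section Posterior

lemma exists_noiseDensity_eq {m : ℕ} {σ : ℝ} (hσ : 0 < σ) :
    ∃ K : ℝ, 0 < K ∧ ∀ y : EuclideanSpace ℝ (Fin m),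
      noiseDensity σ y = K * Real.exp (-(1 / (2 * σ ^ 2) * ‖y‖ ^ 2)) := by
  refine ⟨∏ _l : Fin m, (√(2 * Real.pi * σ ^ 2))⁻¹, by positivity, fun y => ?_⟩
  rw [noiseDensity, EuclideanSpace.real_norm_sq_eq, Finset.mul_sum, ← Finset.sum_neg_distrib,
    Real.exp_sum, ← Finset.prod_mul_distrib]
  refine Finset.prod_congr rfl fun l _ => ?_
  rw [gaussianPDFReal, Real.coe_toNNReal _ (sq_nonneg σ)]
  congr 2
  rw [sub_zero]
  ring

namespace ObservedSystem

variable {d m : ℕ} {M : ObservedSystem d m} {R σ h : ℝ} {k : ℕ}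
  {q : EuclideanSpace ℝ (Fin d) → ℝ} {Y : ℕ → EuclideanSpace ℝ (Fin m)}

lemma exists_likelihoodPrior_eq (hσ : 0 < σ) (hq : IsAdmissiblePrior R q) :
    ∃ K : ℝ, 0 < K ∧ ∀ v ∈ Metric.closedBall (0 : EuclideanSpace ℝ (Fin d)) R,
      M.likelihoodPrior q σ h k Y v = K * Real.exp (-M.gsm q σ h k Y v) := by
  obtain ⟨K, hK, hn⟩ := exists_noiseDensity_eq (m := m) hσ
  refine ⟨∏ _i ∈ Finset.range (k + 1), K, by positivity, fun v hv => ?_⟩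
  simp only [likelihoodPrior, gsm, hn]
  rw [neg_add, neg_neg, Real.exp_add, Real.exp_log (hq.pos v hv), Finset.prod_mul_distrib,
    Finset.mul_sum, ← Finset.sum_neg_distrib, Real.exp_sum]
  ring

/-- The smoothing density is a positive multiple of `exp (-g)` on the closed ball. -/
lemma exists_smoothingDensity_eq (hR : 0 < R) (hσ : 0 < σ) (hq : IsAdmissiblePrior R q)
    (hcont : ContinuousOn (M.gsm q σ h k Y) (Metric.closedBall 0 R)) :
    ∃ K : ℝ, 0 < K ∧ ∀ v ∈ Metric.closedBall (0 : EuclideanSpace ℝ (Fin d)) R,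
      M.smoothingDensity R q σ h k Y v = K * Real.exp (-M.gsm q σ h k Y v) := by
  obtain ⟨K, hK, hl⟩ := exists_likelihoodPrior_eq (M := M) (h := h) (k := k) (Y := Y) hσ hq
  -- Integrability, from continuity on the compact ball, excludes the default value 0 of the
  -- integral, with which the density would vanish identically.
  have hint : 0 < ∫ w in Metric.closedBall (0 : EuclideanSpace ℝ (Fin d)) R,
      M.likelihoodPrior q σ h k Y w := by
    rw [setIntegral_congr_fun measurableSet_closedBall hl,
      setIntegral_pos_iff_support_of_nonneg_ae]
    · rw [Function.support_eq_univ fun w => by positivity, Set.univ_inter]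
      exact Metric.measure_closedBall_pos _ _ hR
    · exact Filter.Eventually.of_forall fun w => by positivity
    · exact (continuousOn_const.mul (Real.continuous_exp.comp_continuousOn
        hcont.neg)).integrableOn_compact (isCompact_closedBall _ _)
  refine ⟨K / ∫ w in Metric.closedBall (0 : EuclideanSpace ℝ (Fin d)) R,
      M.likelihoodPrior q σ h k Y w, by positivity, fun v hv => ?_⟩
  rw [smoothingDensity, if_pos hv, hl v hv]
  ring

lemma isMAP_iff (hR : 0 < R) (hσ : 0 < σ) (hq : IsAdmissiblePrior R q)
    (hcont : ContinuousOn (M.gsm q σ h k Y) (Metric.closedBall 0 R))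
    {a : EuclideanSpace ℝ (Fin d)} : M.IsMAP R q σ h k Y a ↔
      a ∈ Metric.closedBall 0 R ∧ IsMinOn (M.gsm q σ h k Y) (Metric.closedBall 0 R) a := by
  obtain ⟨K, hK, hs⟩ := exists_smoothingDensity_eq hR hσ hq hcont
  refine and_congr_right fun ha => forall₂_congr fun v hv => ?_
  simp only [Set.mem_ofPred_eq]
  rw [hs v hv, hs a ha, mul_le_mul_iff_right₀ hK, Real.exp_le_exp, neg_le_neg_iff]

lemma exists_isMAP (hR : 0 < R) (hσ : 0 < σ) (hq : IsAdmissiblePrior R q)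
    (hcont : ContinuousOn (M.gsm q σ h k Y) (Metric.closedBall 0 R)) :
    ∃ a, M.IsMAP R q σ h k Y a := by
  obtain ⟨a, ha, hmin⟩ := (isCompact_closedBall (0 : EuclideanSpace ℝ (Fin d)) R).exists_isMinOn
    (Metric.nonempty_closedBall.2 hR.le) hcont
  exact ⟨a, (isMAP_iff hR hσ hq hcont).2 ⟨ha, hmin⟩⟩

end ObservedSystem

lemma IsAdmissiblePrior.exists_log_bound {d : ℕ} {R : ℝ} {q : EuclideanSpace ℝ (Fin d) → ℝ}
    (hq : IsAdmissiblePrior R q) : ∃ C : ℝ, 0 < C ∧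
      (∀ v ∈ Metric.closedBall 0 R, |Real.log (q v)| ≤ C) ∧
      (∀ v ∈ Metric.ball 0 R, ‖iteratedFDeriv ℝ 2 (fun w => Real.log (q w)) v‖ ≤ C) ∧
      ∀ v ∈ Metric.ball 0 R, ‖iteratedFDeriv ℝ 3 (fun w => Real.log (q w)) v‖ ≤ C := by
  obtain ⟨C0, h0⟩ := (isCompact_closedBall
    (0 : EuclideanSpace ℝ (Fin d)) R).exists_bound_of_continuousOn
    (hq.continuousOn.log fun v hv => (hq.pos v hv).ne')
  obtain ⟨C2, h2⟩ := hq.bounded_log 2 (by norm_num) (by norm_num)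
  obtain ⟨C3, h3⟩ := hq.bounded_log 3 (by norm_num) (by norm_num)
  have a0 := le_abs_self C0
  have a2 := le_abs_self C2
  have a3 := le_abs_self C3
  have b0 := abs_nonneg C0
  have b2 := abs_nonneg C2
  have b3 := abs_nonneg C3
  exact ⟨|C0| + |C2| + |C3| + 1, by positivity, fun v hv => (h0 v hv).trans (by linarith),
    fun v hv => (h2 v hv).trans (by linarith), fun v hv => (h3 v hv).trans (by linarith)⟩

lemma IsAdmissiblePrior.contDiffOn_log {d : ℕ} {R : ℝ} {q : EuclideanSpace ℝ (Fin d) → ℝ}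
    (hq : IsAdmissiblePrior R q) :
    ContDiffOn ℝ 3 (fun w => Real.log (q w)) (Metric.ball 0 R) :=
  hq.contDiffOn.log fun v hv => (hq.pos v (Metric.ball_subset_closedBall hv)).ne'

end Posterior

/-! ### The noise-free misfit, uniformly in the step size -/

section Misfit

/-- Used with the closed ball inside the open set of solvable initial values: the derivatives of the
path-valued maps are continuous up to the sphere, so compactness bounds them. -/
lemma exists_bound_iteratedFDeriv {E F : Type*} [NormedAddCommGroup E] [NormedSpace ℝ E]
    [NormedAddCommGroup F] [NormedSpace ℝ F] {V : E → F} {U K : Set E} {n : ℕ} (hU : IsOpen U)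
    (hV : ContDiffOn ℝ n V U) (hK : IsCompact K) (hKU : K ⊆ U) :
    ∃ C : ℝ, 0 ≤ C ∧ ∀ v ∈ K, ∀ j ≤ n, ‖iteratedFDeriv ℝ j V v‖ ≤ C := by
  have hj : ∀ j ≤ n, ∃ C : ℝ, ∀ v ∈ K, ‖iteratedFDeriv ℝ j V v‖ ≤ C := fun j hj => by
    have h1 := hV.continuousOn_iteratedFDerivWithin (m := j) (by exact_mod_cast hj)
      hU.uniqueDiffOn
    exact hK.exists_bound_of_continuousOn
      ((h1.congr fun v hv => (iteratedFDerivWithin_of_isOpen j hU hv).symm).mono hKU)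
  choose! C hC using hj
  refine ⟨∑ j ∈ Finset.range (n + 1), |C j|, by positivity, fun v hv j hjn => ?_⟩
  refine (hC j hjn v hv).trans ((le_abs_self _).trans ?_)
  exact Finset.single_le_sum (f := fun j => |C j|) (fun _ _ => abs_nonneg _)
    (Finset.mem_range.2 (Nat.lt_succ_of_le hjn))

variable {d m : ℕ} {T h : ℝ} {k : ℕ}

/-- The squared distances `‖H (x(t) - y(t))‖²` between two observed paths. -/
noncomputable def sqDistPath (H : EuclideanSpace ℝ (Fin d) →L[ℝ] EuclideanSpace ℝ (Fin m))
    (x y : C(Set.Icc (0 : ℝ) T, EuclideanSpace ℝ (Fin d))) : C(Set.Icc (0 : ℝ) T, ℝ) :=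
  pointwiseBilin _ (isBoundedBilinearMap_inner (𝕜 := ℝ)).toContinuousLinearMap
    (H.compLeftContinuous ℝ (Set.Icc (0 : ℝ) T) (x - y))
    (H.compLeftContinuous ℝ (Set.Icc (0 : ℝ) T) (x - y))

lemma sqDistPath_apply (H : EuclideanSpace ℝ (Fin d) →L[ℝ] EuclideanSpace ℝ (Fin m))
    (x y : C(Set.Icc (0 : ℝ) T, EuclideanSpace ℝ (Fin d))) (t : Set.Icc (0 : ℝ) T) :
    sqDistPath H x y t = ‖H (x t) - H (y t)‖ ^ 2 := by
  rw [← real_inner_self_eq_norm_sq, ← map_sub]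
  rfl

lemma contDiff_sqDistPath {n : WithTop ℕ∞}
    (H : EuclideanSpace ℝ (Fin d) →L[ℝ] EuclideanSpace ℝ (Fin m))
    (y : C(Set.Icc (0 : ℝ) T, EuclideanSpace ℝ (Fin d))) :
    ContDiff ℝ n fun x => sqDistPath H x y := by
  unfold sqDistPath
  fun_prop

/-- The quadrature functional `p ↦ (h / 2) ∑_{i ≤ k} p(i h)`. -/
noncomputable def quadrature (hT : 0 ≤ T) (h : ℝ) (k : ℕ) : C(Set.Icc (0 : ℝ) T, ℝ) →L[ℝ] ℝ :=
  (h / 2) • ∑ i ∈ Finset.range (k + 1), ContinuousMap.evalCLM ℝ (gridPoint hT h i)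

lemma quadrature_apply (hT : 0 ≤ T) (p : C(Set.Icc (0 : ℝ) T, ℝ)) :
    quadrature hT h k p = h / 2 * ∑ i ∈ Finset.range (k + 1), p (gridPoint hT h i) := by
  simp [quadrature]

/-- The norm is at most `(k + 1)h/2`, and `k + 1 ≤ 2k`; the result does not depend on `h`. -/
lemma norm_quadrature_le (hT : 0 ≤ T) (hh : 0 < h) (hk : T = k * h) (hk1 : 1 ≤ k) :
    ‖quadrature hT h k‖ ≤ T := by
  refine ContinuousLinearMap.opNorm_le_bound _ hT fun p => ?_
  rw [quadrature_apply, norm_mul, Real.norm_of_nonneg (by positivity)]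
  have h1 : ‖∑ i ∈ Finset.range (k + 1), p (gridPoint hT h i)‖ ≤ (k + 1 : ℕ) * ‖p‖ := by
    refine (norm_sum_le_of_le _ fun i _ => p.norm_coe_le_norm _).trans_eq (by simp)
  have h2 : ((k + 1 : ℕ) : ℝ) ≤ 2 * k := by
    have : (1 : ℝ) ≤ k := by exact_mod_cast hk1
    push_cast; linarith
  calc _ ≤ h / 2 * ((2 * k) * ‖p‖) := by
        gcongr
        exact h1.trans (by gcongr)
    _ = (k * h) * ‖p‖ := by ring
    _ = T * ‖p‖ := by rw [← hk]

end Misfit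

/-! ### Splitting the scaled objective into misfit and perturbation -/

section Decomposition

variable {d m : ℕ} {T h τ : ℝ} {k : ℕ}

/-- The noise functional on pairs of an initial value and a velocity path. -/
noncomputable def noiseFunctionalPair (hT : 0 ≤ T)
    (H : EuclideanSpace ℝ (Fin d) →L[ℝ] EuclideanSpace ℝ (Fin m)) (h : ℝ) (k : ℕ)
    (z : ℕ → EuclideanSpace ℝ (Fin m)) :
    EuclideanSpace ℝ (Fin d) × C(Set.Icc (0 : ℝ) T, EuclideanSpace ℝ (Fin d)) →L[ℝ] ℝ :=
  noiseFunctional hT H h k z ∘L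
    (constMap _ ∘L ContinuousLinearMap.fst ℝ _ _ + volterra hT ∘L ContinuousLinearMap.snd ℝ _ _)

lemma norm_noiseFunctionalPair_le (hT : 0 ≤ T)
    {H : EuclideanSpace ℝ (Fin d) →L[ℝ] EuclideanSpace ℝ (Fin m)}
    {z : ℕ → EuclideanSpace ℝ (Fin m)} (hh : 0 < h) (hk : T = k * h) (hτ : 0 ≤ τ)
    (hz : noiseSize h k z ≤ τ ^ 2) :
    ‖noiseFunctionalPair hT H h k z‖ ≤ ‖H‖ * (2 + 2 * T) * τ := by
  refine ContinuousLinearMap.opNorm_le_bound _ (by positivity) fun w => ?_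
  have h1 : noiseFunctionalPair hT H h k z w = noiseFunctional hT H h k z (constMap _ w.1)
      + noiseFunctional hT H h k z (volterra hT w.2) := by
    simp [noiseFunctionalPair]
  rw [h1, Real.norm_eq_abs]
  calc _ ≤ ‖H‖ * τ * ‖w.1‖ + ‖H‖ * (1 + 2 * T) * τ * ‖w.2‖ :=
        (abs_add_le _ _).trans (add_le_add (abs_noiseFunctional_constMap_le hT hh hτ hz _)
          (abs_noiseFunctional_volterra_le hT hh hk hτ hz _))
    _ ≤ ‖H‖ * τ * ‖w‖ + ‖H‖ * (1 + 2 * T) * τ * ‖w‖ := by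
        gcongr
        · exact norm_fst_le w
        · exact norm_snd_le w
    _ = _ := by ring

namespace ObservedSystem

variable {M : ObservedSystem d m} {R σ : ℝ} {u v : EuclideanSpace ℝ (Fin d)}
  {q : EuclideanSpace ℝ (Fin d) → ℝ} {z : ℕ → EuclideanSpace ℝ (Fin m)}

variable (M) in
/-- The pair of the initial value and the velocity along the solution path. -/
noncomputable def velocityPair (hT : 0 ≤ T) (v : EuclideanSpace ℝ (Fin d)) :
    EuclideanSpace ℝ (Fin d) × C(Set.Icc (0 : ℝ) T, EuclideanSpace ℝ (Fin d)) :=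
  (v, pathField M.A M.B M.f (M.path hT v))

/-- The path is its initial value plus the integral of its velocity, so the noise term factors
through a small random functional and a deterministic C³ map. -/
lemma noiseFunctionalPair_velocityPair (hT : 0 ≤ T) (hv : v ∈ solvable M.A M.B M.f hT) :
    noiseFunctionalPair hT M.H h k z (M.velocityPair hT v)
      = noiseFunctional hT M.H h k z (M.path hT v) := by
  conv_rhs => rw [path, solutionPath_spec hv]
  rfl

lemma contDiffOn_velocityPair (hT : 0 ≤ T) :
    ContDiffOn ℝ 3 (M.velocityPair hT) (solvable M.A M.B M.f hT) :=
  contDiffOn_id.prodMk ((contDiff_pathField M.A M.B M.f).comp_contDiffOn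
    (contDiffOn_solutionPath M.A M.B M.f hT))

lemma TrappingBall.obs_eq (htrap : M.TrappingBall R) (hR : 0 < R) (hT : 0 ≤ T) (hh : 0 < h)
    (hk : T = k * h) (hv : ‖v‖ ≤ R) {i : ℕ} (hi : i ≤ k) :
    M.obs (i * h) v = M.H (M.path hT v (gridPoint hT h i)) := by
  rw [(htrap.path_spec hR hv hT).2, coe_gridPoint hT hh hk hi, obs]

/-- Up to a constant, `σ² h g` is the quadrature of the misfit plus a linear functional of the
noise and a multiple of `log q`. -/
lemma TrappingBall.mul_gsm_eq (htrap : M.TrappingBall R) (hR : 0 < R) (hT : 0 ≤ T) (hh : 0 < h)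
    (hk : T = k * h) (hσ : 0 < σ) (hu : ‖u‖ ≤ R) (hv : ‖v‖ ≤ R) :
    σ ^ 2 * h * M.gsm q σ h k (M.observations h u z) v
      = quadrature hT h k (sqDistPath M.H (M.path hT v) (M.path hT u))
        + (-noiseFunctionalPair hT M.H h k z (M.velocityPair hT v)
          + -(σ ^ 2 * h) * Real.log (q v))
        + (noiseFunctional hT M.H h k z (M.path hT u)
          + h / 2 * ∑ i ∈ Finset.range (k + 1), ‖z i‖ ^ 2) := by
  rw [noiseFunctionalPair_velocityPair hT (htrap.path_spec hR hv hT).1, noiseFunctional_apply,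
    noiseFunctional_apply, quadrature_apply, gsm]
  have h1 : ∀ i ∈ Finset.range (k + 1), ‖M.observations h u z i - M.obs (i * h) v‖ ^ 2
      = sqDistPath M.H (M.path hT v) (M.path hT u) (gridPoint hT h i)
        + 2 * inner ℝ (z i) (M.H (M.path hT u (gridPoint hT h i)))
        - 2 * inner ℝ (z i) (M.H (M.path hT v (gridPoint hT h i))) + ‖z i‖ ^ 2 := by
    intro i hi
    have hi' : i ≤ k := Nat.lt_succ_iff.1 (Finset.mem_range.1 hi)
    rw [observations, htrap.obs_eq hR hT hh hk hv hi', htrap.obs_eq hR hT hh hk hu hi',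
      sqDistPath_apply, add_sub_right_comm, norm_add_sq_real, real_inner_comm, inner_sub_right,
      norm_sub_rev]
    ring
  rw [Finset.sum_congr rfl h1, Finset.sum_add_distrib, Finset.sum_sub_distrib,
    Finset.sum_add_distrib, ← Finset.mul_sum, ← Finset.mul_sum]
  field_simp
  ring

/-- The weight `h/2` cancels the `1/h` in the observability bound, so the growth constant is
independent of `h`. -/
lemma TrappingBall.quadrature_ge (htrap : M.TrappingBall R) (hR : 0 < R) {hmax c : ℝ}
    (hobs : M.Observability R u T hmax c) (hT : 0 ≤ T) (hh : 0 < h) (hk : T = k * h)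
    (hmax' : h ≤ hmax) (hv : ‖v‖ ≤ R) :
    c / 2 * ‖v - u‖ ^ 2
      ≤ quadrature hT h k (sqDistPath M.H (M.path hT v) (M.path hT u)) := by
  have h1 := hobs.lower_bound k h hh hk hmax' v (by simpa using hv)
  have h2 : ∑ i ∈ Finset.range (k + 1), ‖M.obs (i * h) v - M.obs (i * h) u‖ ^ 2
      = ∑ i ∈ Finset.range (k + 1),
        sqDistPath M.H (M.path hT v) (M.path hT u) (gridPoint hT h i) := by
    refine Finset.sum_congr rfl fun i hi => ?_
    have hi' : i ≤ k := Nat.lt_succ_iff.1 (Finset.mem_range.1 hi)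
    rw [htrap.obs_eq hR hT hh hk hv hi', htrap.obs_eq hR hT hh hk hobs.norm_lt.le hi',
      sqDistPath_apply]
  rw [h2] at h1
  rw [quadrature_apply, norm_sub_rev]
  have h3 := mul_le_mul_of_nonneg_left h1 (by positivity : 0 ≤ h / 2)
  refine le_trans (le_of_eq ?_) h3
  field_simp

end ObservedSystem

end Decomposition

/-! ### Assembly of the estimates -/

lemma norm_iteratedFDeriv_clm_comp_add_smul_le {E F : Type*} [NormedAddCommGroup E]
    [NormedSpace ℝ E] [NormedAddCommGroup F] [NormedSpace ℝ F] (l : F →L[ℝ] ℝ) {V : E → F}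
    {f : E → ℝ} (r : ℝ) {n j : ℕ} (hj : j ≤ n) {x : E} (hV : ContDiffAt ℝ n V x)
    (hf : ContDiffAt ℝ n f x) :
    ‖iteratedFDeriv ℝ j (fun v => l (V v) + r * f v) x‖
      ≤ ‖l‖ * ‖iteratedFDeriv ℝ j V x‖ + |r| * ‖iteratedFDeriv ℝ j f x‖ := by
  have hV' : ContDiffAt ℝ j V x := hV.of_le (by exact_mod_cast hj)
  have hf' : ContDiffAt ℝ j f x := hf.of_le (by exact_mod_cast hj)
  have h1 : (fun v => l (V v) + r * f v) = (l ∘ V) + (r • f) := rfl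
  have hr : ContDiffAt ℝ j (r • f) x := contDiffAt_const.smul hf'
  rw [h1, iteratedFDeriv_add_apply (l.contDiff.contDiffAt.comp x hV') hr,
    iteratedFDeriv_const_smul_apply hf']
  refine (norm_add_le _ _).trans (add_le_add ?_ ?_)
  · exact l.norm_iteratedFDeriv_comp_left hV' le_rfl
  · rw [norm_smul, Real.norm_eq_abs]

theorem mainTheorem5 {d m : ℕ} (M : ObservedSystem d m) (R : ℝ) (hR : 0 < R)
    (htrap : M.TrappingBall R) (u : EuclideanSpace ℝ (Fin d)) (T hmax c : ℝ) (hT : 0 < T)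
    (hobs : M.Observability R u T hmax c) :
    ∃ N D : ℝ, 0 < D ∧ D ≤ N ∧
      ∀ q : EuclideanSpace ℝ (Fin d) → ℝ, IsAdmissiblePrior R q →
      ∀ ε : ℝ, 0 < ε → ε ≤ 1 → ∃ S : ℝ, 0 < S ∧
      ∀ (k : ℕ) (h σ : ℝ), 0 < h → T = k * h → h ≤ hmax → 0 < σ → σ * √h ≤ S →
      ∀ (Ω : Type*) [MeasurableSpace Ω] (P : Measure Ω) [IsProbabilityMeasure P]
        (Z : ℕ → Ω → EuclideanSpace ℝ (Fin m)), IsGaussianNoise σ P Z →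
      ∃ E : Set Ω, MeasurableSet E ∧ ENNReal.ofReal (1 - ε) ≤ P E ∧ ∀ ω ∈ E,
        let Y : ℕ → EuclideanSpace ℝ (Fin m) := M.observations h u (fun j => Z j ω)
        let g : EuclideanSpace ℝ (Fin d) → ℝ := M.gsm q σ h k Y
        (∃ a, M.IsMAP R q σ h k Y a) ∧
        ∀ x₀ ∈ Metric.closedBall (0 : EuclideanSpace ℝ (Fin d)) R, ‖x₀ - u‖ < D →
          NewtonWellDefined R g x₀ ∧
          ∀ a, M.IsMAP R q σ h k Y a →
            ‖x₀ - a‖ < N ∧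
            ∀ i : ℕ, ‖newtonIterate g x₀ i - a‖ ≤ N * (‖x₀ - a‖ / N) ^ (2 ^ i) := by
  have hT0 := hT.le
  have hc := hobs.c_pos
  have huR := hobs.norm_lt
  have hopen := isOpen_solvable M.A M.B M.f hT0
  have hKU : Metric.closedBall (0 : EuclideanSpace ℝ (Fin d)) R ⊆ solvable M.A M.B M.f hT0 :=
    fun v hv => (htrap.path_spec hR (by simpa using hv) hT0).1
  have hbU := Metric.ball_subset_closedBall.trans hKU
  have hcomp := isCompact_closedBall (0 : EuclideanSpace ℝ (Fin d)) R
  let W := fun v => sqDistPath M.H (M.path hT0 v) (M.path hT0 u)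
  have hW : ContDiffOn ℝ 3 W (solvable M.A M.B M.f hT0) :=
    (contDiff_sqDistPath M.H (M.path hT0 u)).comp_contDiffOn
      (contDiffOn_solutionPath M.A M.B M.f hT0)
  have hV : ContDiffOn ℝ 3 (M.velocityPair hT0) (solvable M.A M.B M.f hT0) :=
    ObservedSystem.contDiffOn_velocityPair hT0
  -- These bounds concern path-valued maps only. The step size enters later, through functionals of
  -- controlled norm, so `N` and `D` can be fixed before `q`, `h` and `σ`.
  obtain ⟨CW, hCW0, hCW⟩ := exists_bound_iteratedFDeriv (n := 3) hopen hW hcomp hKU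
  obtain ⟨CV, hCV0, hCV⟩ := exists_bound_iteratedFDeriv (n := 3) hopen hV hcomp hKU
  set C : ℝ := T * CW
  have hC : 0 ≤ C := by positivity
  set N : ℝ := c / 4 / (C + 1) with hN
  -- The first entry keeps the ball about `u` inside the domain; the second limits the loss of
  -- convexity of `φ` to `c/2`.
  set r : ℝ := min (R - ‖u‖) (c / (2 * (C + 1)))
  set D : ℝ := min (N / 2) (r / 3)
  have hN0 : 0 < N := by positivity
  have hr0 : 0 < r := lt_min (by linarith) (by positivity)
  have hD0 : 0 < D := lt_min (by positivity) (by positivity)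
  have hDN : 2 * D ≤ N := by linarith [min_le_left (N / 2) (r / 3)]
  have hDr : 3 * D ≤ r := by linarith [min_le_right (N / 2) (r / 3)]
  refine ⟨N, D, hD0, by linarith, fun q hq ε hε _ => ?_⟩
  obtain ⟨Cq, hCq0, hq0, hq2, hq3⟩ := hq.exists_log_bound
  -- the admissible size of the perturbation, and the corresponding size of the noise
  set η : ℝ := min (c * D ^ 2 / 16) (min (c / 8) (1 / 2))
  have hη0 : 0 < η := lt_min (by positivity) (lt_min (by positivity) (by norm_num))
  have hη1 : 2 * η ≤ c * D ^ 2 / 8 := by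
    linarith [min_le_left (c * D ^ 2 / 16) (min (c / 8) (1 / 2))]
  have hη2 : 2 * η ≤ c / 4 := by
    linarith [(min_le_right (c * D ^ 2 / 16) (min (c / 8) (1 / 2))).trans (min_le_left _ _)]
  have hη3 : 2 * η ≤ 1 := by
    linarith [(min_le_right (c * D ^ 2 / 16) (min (c / 8) (1 / 2))).trans (min_le_right _ _)]
  set τ : ℝ := η / (‖M.H‖ * (2 + 2 * T) * CV + 1) with hτ
  have hτ0 : 0 < τ := by positivity
  have hτη : ‖M.H‖ * (2 + 2 * T) * τ * CV ≤ η := by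
    have h1 : (‖M.H‖ * (2 + 2 * T) * CV + 1) * τ = η := by rw [hτ]; field_simp
    linarith
  set K : ℝ := 2 * T * (1 + T) * m with hK
  have hK0 : 0 ≤ K := by positivity
  -- The first entry makes the prior's share of `p` at most `η`; the second is what Markov's
  -- inequality needs to bound the failure probability by `ε`.
  set S : ℝ := √(min (η / Cq) (ε * τ ^ 2 / (K + 1)))
  have hS0 : 0 < min (η / Cq) (ε * τ ^ 2 / (K + 1)) := lt_min (by positivity) (by positivity)
  refine ⟨S, Real.sqrt_pos.2 hS0, ?_⟩
  intro k h σ hh hk hhmax hσ hσS Ω _ P _ Z hZ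
  have hk1 : 1 ≤ k := by
    rcases Nat.eq_zero_or_pos k with rfl | hk0
    · simp only [Nat.cast_zero, zero_mul] at hk; exact absurd hk hT.ne'
    · exact hk0
  have hs2 : (σ * √h) ^ 2 ≤ min (η / Cq) (ε * τ ^ 2 / (K + 1)) := by
    rw [← Real.sq_sqrt hS0.le]
    gcongr
  have hsq : (σ * √h) ^ 2 = σ ^ 2 * h := by rw [mul_pow, Real.sq_sqrt hh.le]
  have hs0 : 0 < σ ^ 2 * h := by positivity
  have hsη : σ ^ 2 * h * Cq ≤ η := by
    rw [← hsq, ← le_div_iff₀ hCq0]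
    exact hs2.trans (min_le_left _ _)
  refine ⟨{ω | noiseSize h k (fun j => Z j ω) ≤ τ ^ 2},
    measurableSet_le (hZ.measurable_noiseSize h k) measurable_const,
    hZ.prob_noiseSize_le hh hk hk1 (by positivity) ?_, fun ω hω => ?_⟩
  · calc K * (σ * √h) ^ 2 ≤ (K + 1) * (ε * τ ^ 2 / (K + 1)) := by
          gcongr
          · linarith
          · exact hs2.trans (min_le_right _ _)
      _ = ε * τ ^ 2 := by field_simp
  intro Y g
  set l := noiseFunctionalPair hT0 M.H h k (fun j => Z j ω)
  have hlη : ‖-l‖ * CV ≤ η := by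
    refine le_trans ?_ hτη
    gcongr
    refine (ContinuousLinearMap.opNorm_neg l).trans_le ?_
    exact norm_noiseFunctionalPair_le hT0 hh hk hτ0.le hω
  let φ : EuclideanSpace ℝ (Fin d) → ℝ := fun v => quadrature hT0 h k (W v)
  let p : EuclideanSpace ℝ (Fin d) → ℝ := fun v =>
    (-l) (M.velocityPair hT0 v) + -(σ ^ 2 * h) * Real.log (q v)
  have habs : |-(σ ^ 2 * h)| = σ ^ 2 * h := by rw [abs_neg, abs_of_pos hs0]
  have hφ : ContDiffOn ℝ 3 φ (Metric.ball 0 R) :=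
    (quadrature hT0 h k).contDiff.comp_contDiffOn (hW.mono hbU)
  have hp : ContDiffOn ℝ 3 p (Metric.ball 0 R) :=
    ((-l).contDiff.comp_contDiffOn (hV.mono hbU)).add
      (contDiffOn_const.mul hq.contDiffOn_log)
  have hpd : ∀ j ≤ 3, ∀ v ∈ Metric.ball (0 : EuclideanSpace ℝ (Fin d)) R,
      ‖iteratedFDeriv ℝ j (fun w => Real.log (q w)) v‖ ≤ Cq →
      ‖iteratedFDeriv ℝ j p v‖ ≤ 2 * η := by
    intro j hj v hv hqv
    refine (norm_iteratedFDeriv_clm_comp_add_smul_le (n := 3) (-l) (-(σ ^ 2 * h)) hj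
      (hV.contDiffAt (hopen.mem_nhds (hbU hv)))
      (hq.contDiffOn_log.contDiffAt (Metric.isOpen_ball.mem_nhds hv))).trans ?_
    rw [habs, two_mul]
    refine add_le_add (le_trans ?_ hlη) (le_trans ?_ hsη)
    · gcongr
      exact hCV v (Metric.ball_subset_closedBall hv) j hj
    · gcongr
  have hp0 : ∀ v ∈ Metric.closedBall (0 : EuclideanSpace ℝ (Fin d)) R, |p v| ≤ 2 * η := by
    intro v hv
    rw [two_mul]
    refine (abs_add_le _ _).trans (add_le_add (le_trans ?_ hlη) (le_trans ?_ hsη))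
    · refine ((-l).le_opNorm _).trans ?_
      gcongr
      rw [← norm_iteratedFDeriv_zero (𝕜 := ℝ) (f := M.velocityPair hT0)]
      exact hCV v hv 0 (by norm_num)
    · rw [abs_mul, habs]
      gcongr
      exact hq0 v hv
  have hφ3 : ∀ v ∈ Metric.ball 0 R, ‖iteratedFDeriv ℝ 3 φ v‖ ≤ C := by
    intro v hv
    have h1 : ContDiffAt ℝ 3 W v := hW.contDiffAt (hopen.mem_nhds (hbU hv))
    refine ((quadrature hT0 h k).norm_iteratedFDeriv_comp_left h1 le_rfl).trans ?_
    exact mul_le_mul (norm_quadrature_le hT0 hh hk hk1)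
      (hCW v (Metric.ball_subset_closedBall hv) 3 le_rfl) (norm_nonneg _) hT0
  have hφ0 : φ u = 0 := by
    simp [φ, W, quadrature_apply, sqDistPath_apply]
  have hφlow : ∀ v ∈ Metric.closedBall 0 R, c / 2 * ‖v - u‖ ^ 2 ≤ φ v := fun v hv =>
    htrap.quadrature_ge hR hobs hT0 hh hk hhmax (by simpa using hv)
  have hg : ∀ v ∈ Metric.closedBall 0 R, σ ^ 2 * h * g v = φ v + p v
      + (noiseFunctional hT0 M.H h k (fun j => Z j ω) (M.path hT0 u)
          + h / 2 * ∑ i ∈ Finset.range (k + 1), ‖Z i ω‖ ^ 2) := fun v hv =>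
    htrap.mul_gsm_eq hR hT0 hh hk hσ huR.le (by simpa using hv)
  have hcont : ContinuousOn g (Metric.closedBall 0 R) := by
    have h1 : ContinuousOn (fun v => (σ ^ 2 * h)⁻¹ * (φ v + p v
        + (noiseFunctional hT0 M.H h k (fun j => Z j ω) (M.path hT0 u)
          + h / 2 * ∑ i ∈ Finset.range (k + 1), ‖Z i ω‖ ^ 2))) (Metric.closedBall 0 R) := by
      refine continuousOn_const.mul (ContinuousOn.add (ContinuousOn.add ?_ (ContinuousOn.add ?_
        ?_)) continuousOn_const)
      · exact (quadrature hT0 h k).continuous.comp_continuousOn (hW.continuousOn.mono hKU)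
      · exact (-l).continuous.comp_continuousOn (hV.continuousOn.mono hKU)
      · exact continuousOn_const.mul (hq.continuousOn.log fun v hv => (hq.pos v hv).ne')
    exact h1.congr fun v hv =>
      (inv_mul_cancel_left₀ hs0.ne' (g v)).symm.trans (congrArg _ (hg v hv))
  have hex := ObservedSystem.exists_isMAP hR hσ hq hcont
  have hkey : ∀ x₀ a, ‖x₀ - u‖ < D → M.IsMAP R q σ h k Y a → NewtonWellDefined R g x₀ ∧
      ‖x₀ - a‖ < N ∧ ∀ i, ‖newtonIterate g x₀ i - a‖ ≤ N * (‖x₀ - a‖ / N) ^ (2 ^ i) := by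
    intro x₀ a hx₀ ha
    obtain ⟨ha, hmin⟩ := (ObservedSystem.isMAP_iff hR hσ hq hcont).1 ha
    exact newton_convergence_of_perturbation hc hC hs0 hφ hp hg hφ0 hφlow hφ3
      (fun v hv => (hp0 v hv).trans hη1)
      (fun v hv => (hpd 2 (by norm_num) v hv (hq2 v hv)).trans hη2)
      (fun v hv => (hpd 3 le_rfl v hv (hq3 v hv)).trans hη3)
      hN (min_le_left _ _) (min_le_right _ _) hD0 hDN hDr hx₀ ha hmin
  refine ⟨hex, fun x₀ _ hx₀ => ⟨?_, fun a ha => (hkey x₀ a hx₀ ha).2⟩⟩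
  -- Well-definedness does not mention a maximizer, but its proof runs through one, so existence is
  -- used here.
  obtain ⟨a, ha⟩ := hex
  exact (hkey x₀ a hx₀ ha).1
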